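/- Let $\Bbbk$ be a field and let $f:C\to D$ and $\pi:C\twoheadrightarrow D'$ be morphisms of (coassociative, counital) $\Bbbk$-coalgebras, with $\pi$ surjective. The codominion of $f$ is the smallest regular quotient $q:C\twoheadrightarrow \overline{D}$ in the category of $\Bbbk$-coalgebras through which $f$ factors: $q$ is a coequalizer of a pair of coalgebra morphisms into $C$, $f$ factors through $q$, and $q$ factors through every other such quotient of $C$. We say that $f$ dominates $\pi$ if $\pi$ factors as $C\xrightarrow{q}\overline{D}\to D'$ in the category of coalgebras. The following conditions are equivalent: (a) $f$ dominates $\pi$. (b) For any pair $f_1,f_2:C'\to C$ of coalgebra morphisms with $ff_1=ff_2$ we have $\pi f_1=\pi f_2$. (c) $\pi p_1=\pi p_2$, where $p_1,p_2:C\times_D C\to C$ are the projections of the pullback of $f$ along itself in the category of $\Bbbk$-coalgebras. (d) The two maps $\mathrm{id}_C\otimes\varepsilon,\ \varepsilon\otimes\mathrm{id}_C: C\square_D C\to C$ become equal after composition with $\pi$, where $$C\square_D C=\Big\{\textstyle\sum_i a_i\otimes b_i\in C\otimes C\ \Big|\ \sum_i a_{i,1}\otimes f(a_{i,2})\otimes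 b_i=\sum_i a_i\otimes f(b_{i,1})\otimes b_{i,2}\in C\otimes D\otimes C\Big\}$$ is the cotensor product and $\varepsilon$ is the counit of $C$. (e) For any $C$-bicomodule $X$, with coactions $x\mapsto x_0\otimes x_1\in X\otimes C$ and $x\mapsto x_{-1}\otimes x_0\in C\otimes X$, and any $x\in X$, $$x_0\otimes f(x_1)=x_0\otimes f(x_{-1})\in X\otimes D\ \Longrightarrow\ x_0\otimes\pi(x_1)=x_0\otimes\pi(x_{-1})\in X\otimes D'.$$ (f) The same condition as in (e), but only for finite-dimensional bicomodules $X$. (g) For any linear map $\varphi:V\to W$ between right $C$-comodules with structure maps $\rho_V:V\to V\otimes C$ and $\rho_W:W\to W\otimes C$, if $\varphi$ is a morphism of $D$-comodules via corestriction along $f$ then it is a morphism of $D'$-comodules via corestriction along $\pi$: $(\mathrm{id}_W\otimes f)\circ\rho_W\circ\varphi=(\varphi\otimes f)\circ\rho_V$ implies $(\mathrm{id}_W\otimes\pi)\circ\rho_W\circ\varphi=(\varphi\otimes\pi)\circ\rho_V$. (h) The same condition as in (g), but only for finite-dimensional comodules $V$ and $W$. Moreover, if $f$ factors through $\pi$ (i.e.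 $f=g\pi$ for some coalgebra morphism $g:D'\to D$), then each of these conditions is also equivalent to the existence of coalgebra morphisms $\overline{D}\to D'\to D$ such that $C\xrightarrow{q}\overline{D}\to D'$ equals $\pi$ and the composition $C\xrightarrow{q}\overline{D}\to D'\to D$ equals $f$. -/

import Mathlib

open scoped TensorProduct
open CategoryTheory

universe u

namespace CoalgDom

section Codominion

variable {𝒞 : Type*} [Category 𝒞]

/-- `q : c ⟶ c'` is the codominion of `f : c ⟶ d`: the smallest regular quotient object of `c`
through which `f` factors. A quotient `q` is smaller than a quotient `r` when `q` factors
through `r`. -/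
structure IsCodominion {c d c' : 𝒞} (f : c ⟶ d) (q : c ⟶ c') : Prop where
  regular : IsRegularEpi q
  factors : ∃ g : c' ⟶ d, q ≫ g = f
  smallest : ∀ (e : 𝒞) (r : c ⟶ e), IsRegularEpi r → (∃ g : e ⟶ d, r ≫ g = f) →
    ∃ t : e ⟶ c', r ≫ t = q

/-- `f : c ⟶ d` dominates the quotient object `π : c ⟶ d'`: the quotient `π` factors through the
codominion of `f`. (For epic `π` the factor `p` is automatically epic.) -/
def Dominates {c d d' : 𝒞} (f : c ⟶ d) (π : c ⟶ d') : Prop :=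
  ∃ (c' : 𝒞) (q : c ⟶ c'), IsCodominion f q ∧ ∃ p : c' ⟶ d', q ≫ p = π

/-- The variant of domination in which `d'` is moreover required to lie between the codominion
and `d`: there is a factorization `c ⟶ c' ⟶ d' ⟶ d` of `f`, with `c ⟶ c'` the codominion of `f`
and `c ⟶ c' ⟶ d'` equal to `π`. -/
def DominatesBetween {c d d' : 𝒞} (f : c ⟶ d) (π : c ⟶ d') : Prop :=
  ∃ (c' : 𝒞) (q : c ⟶ c') (p : c' ⟶ d') (g : d' ⟶ d),
    IsCodominion f q ∧ q ≫ p = π ∧ q ≫ p ≫ g = f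

end Codominion

section Comodules

variable (k : Type*) [Field k]

/-- A right comodule structure `v ↦ v₀ ⊗ v₁` over the coalgebra `C` on the vector space `V`. -/
structure RightComodule (C : Type*) [AddCommGroup C] [Module k C] [Coalgebra k C]
    (V : Type*) [AddCommGroup V] [Module k V] where
  coact : V →ₗ[k] V ⊗[k] C
  coassoc : (TensorProduct.assoc k V C C).toLinearMap ∘ₗ coact.rTensor C ∘ₗ coact =
    (Coalgebra.comul (R := k) (A := C)).lTensor V ∘ₗ coact
  counit : (Coalgebra.counit (R := k) (A := C)).lTensor V ∘ₗ coact =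
    (TensorProduct.mk k V k).flip 1

/-- A left comodule structure `v ↦ v₋₁ ⊗ v₀` over the coalgebra `C` on the vector space `V`. -/
structure LeftComodule (C : Type*) [AddCommGroup C] [Module k C] [Coalgebra k C]
    (V : Type*) [AddCommGroup V] [Module k V] where
  coact : V →ₗ[k] C ⊗[k] V
  coassoc : (TensorProduct.assoc k C C V).toLinearMap ∘ₗ
      (Coalgebra.comul (R := k) (A := C)).rTensor V ∘ₗ coact = coact.lTensor C ∘ₗ coact
  counit : (Coalgebra.counit (R := k) (A := C)).rTensor V ∘ₗ coact = TensorProduct.mk k k V 1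

/-- A `C`-bicomodule structure on `X`: commuting left and right `C`-comodule structures. -/
structure Bicomodule (C : Type*) [AddCommGroup C] [Module k C] [Coalgebra k C]
    (X : Type*) [AddCommGroup X] [Module k X] where
  left : LeftComodule k C X
  right : RightComodule k C X
  comm : (TensorProduct.assoc k C X C).toLinearMap ∘ₗ left.coact.rTensor C ∘ₗ right.coact =
    right.coact.lTensor C ∘ₗ left.coact

variable {k}
variable {C : Type*} [AddCommGroup C] [Module k C] [Coalgebra k C]
variable {D : Type*} [AddCommGroup D] [Module k D] [Coalgebra k D]
variable {V : Type*} [AddCommGroup V] [Module k V]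
variable {W : Type*} [AddCommGroup W] [Module k W]

/-- Corestriction of a right `C`-comodule to a right `D`-comodule along `f : C → D`. -/
def RightComodule.corestrict (M : RightComodule k C V) (f : C →ₗc[k] D) :
    RightComodule k D V where
  coact := f.toLinearMap.lTensor V ∘ₗ M.coact
  coassoc := by
    have h := congrArg (fun g => (TensorProduct.map f.toLinearMap f.toLinearMap).lTensor V ∘ₗ g)
      M.coassoc
    have h2 : (TensorProduct.map f.toLinearMap f.toLinearMap) ∘ₗ Coalgebra.comul =
      Coalgebra.comul ∘ₗ f.toLinearMap := f.map_comp_comul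
    have h3 : (TensorProduct.assoc k V D D).toLinearMap ∘ₗ
          (f.toLinearMap.lTensor V ∘ₗ M.coact).rTensor D ∘ₗ f.toLinearMap.lTensor V =
        (TensorProduct.map f.toLinearMap f.toLinearMap).lTensor V ∘ₗ
          (TensorProduct.assoc k V C C).toLinearMap ∘ₗ M.coact.rTensor C := by
      ext v c
      simp only [LinearMap.coe_comp, Function.comp_apply,
        TensorProduct.AlgebraTensorModule.curry_apply, LinearMap.restrictScalars_self,
        TensorProduct.curry_apply, LinearMap.lTensor_tmul, LinearMap.rTensor_tmul,
        LinearEquiv.coe_coe]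
      induction M.coact v using TensorProduct.induction_on with
      | zero => simp
      | tmul x y => simp
      | add x y hx hy => simp only [map_add, TensorProduct.add_tmul, hx, hy]
    have h4 := congrArg (fun g => g ∘ₗ M.coact) h3
    have h5 := congrArg (fun g => g.lTensor V ∘ₗ M.coact) h2
    simp only [LinearMap.lTensor_comp, LinearMap.comp_assoc] at h h4 h5 ⊢
    rw [h4, h, h5]
  counit := by
    rw [← LinearMap.comp_assoc, ← LinearMap.lTensor_comp,
      show Coalgebra.counit ∘ₗ f.toLinearMap = Coalgebra.counit from f.counit_comp]
    exact M.counit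

/-- Corestriction of a left `C`-comodule to a left `D`-comodule along `f : C → D`. -/
def LeftComodule.corestrict (M : LeftComodule k C V) (f : C →ₗc[k] D) :
    LeftComodule k D V where
  coact := f.toLinearMap.rTensor V ∘ₗ M.coact
  coassoc := by
    have h := congrArg (fun g => TensorProduct.map f.toLinearMap (f.toLinearMap.rTensor V) ∘ₗ g)
      M.coassoc
    have h2 : (TensorProduct.map f.toLinearMap f.toLinearMap) ∘ₗ Coalgebra.comul =
      Coalgebra.comul ∘ₗ f.toLinearMap := f.map_comp_comul
    have h3 : (f.toLinearMap.rTensor V ∘ₗ M.coact).lTensor D ∘ₗ f.toLinearMap.rTensor V =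
        TensorProduct.map f.toLinearMap (f.toLinearMap.rTensor V) ∘ₗ M.coact.lTensor C := by
      ext; simp
    have h4 : (TensorProduct.assoc k D D V).toLinearMap ∘ₗ
          (TensorProduct.map f.toLinearMap f.toLinearMap).rTensor V =
        TensorProduct.map f.toLinearMap (f.toLinearMap.rTensor V) ∘ₗ
          (TensorProduct.assoc k C C V).toLinearMap := by
      ext; simp
    have h5 := congrArg (fun g => g.rTensor V) h2
    simp only [LinearMap.rTensor_comp] at h5
    calc _ = (TensorProduct.assoc k D D V).toLinearMap ∘ₗ
          ((Coalgebra.comul (R := k) (A := D)).rTensor V ∘ₗ f.toLinearMap.rTensor V) ∘ₗ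
            M.coact := rfl
      _ = ((TensorProduct.assoc k D D V).toLinearMap ∘ₗ
          (TensorProduct.map f.toLinearMap f.toLinearMap).rTensor V) ∘ₗ
            (Coalgebra.comul (R := k) (A := C)).rTensor V ∘ₗ M.coact := by rw [← h5]; rfl
      _ = (TensorProduct.map f.toLinearMap (f.toLinearMap.rTensor V) ∘ₗ M.coact.lTensor C) ∘ₗ
            M.coact := by rw [h4]; exact h
      _ = _ := by rw [← h3]; rfl
  counit := by
    rw [← LinearMap.comp_assoc, ← LinearMap.rTensor_comp,
      show Coalgebra.counit ∘ₗ f.toLinearMap = Coalgebra.counit from f.counit_comp]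
    exact M.counit

variable (k C) in
/-- `C` as a right comodule over itself. -/
def RightComodule.regular : RightComodule k C C where
  coact := Coalgebra.comul
  coassoc := Coalgebra.coassoc
  counit := Coalgebra.lTensor_counit_comp_comul

variable (k C) in
/-- `C` as a left comodule over itself. -/
def LeftComodule.regular : LeftComodule k C C where
  coact := Coalgebra.comul
  coassoc := Coalgebra.coassoc
  counit := Coalgebra.rTensor_counit_comp_comul

/-- A linear map `φ : V → W` between right comodules is a comodule morphism. -/
def IsColinear (M : RightComodule k D V) (N : RightComodule k D W) (φ : V →ₗ[k] W) : Prop :=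
  N.coact ∘ₗ φ = φ.rTensor D ∘ₗ M.coact

/-- The cotensor product `V □_D W ⊆ V ⊗ W`. -/
def cotensor (M : RightComodule k D V) (N : LeftComodule k D W) : Submodule k (V ⊗[k] W) :=
  LinearMap.eqLocus ((TensorProduct.assoc k V D W).toLinearMap ∘ₗ M.coact.rTensor W)
    (N.coact.lTensor V)

/-- `C □_D C`, where `C` is a `D`-comodule on both sides through `f : C → D`. -/
def selfCotensor (f : C →ₗc[k] D) : Submodule k (C ⊗[k] C) :=
  cotensor ((RightComodule.regular k C).corestrict f) ((LeftComodule.regular k C).corestrict f)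

variable (k C) in
/-- The map `id ⊗ ε : C ⊗ C → C`. -/
def idTensorCounit : C ⊗[k] C →ₗ[k] C :=
  (TensorProduct.rid k C).toLinearMap ∘ₗ (Coalgebra.counit (R := k) (A := C)).lTensor C

variable (k C) in
/-- The map `ε ⊗ id : C ⊗ C → C`. -/
def counitTensorId : C ⊗[k] C →ₗ[k] C :=
  (TensorProduct.lid k C).toLinearMap ∘ₗ (Coalgebra.counit (R := k) (A := C)).rTensor C

/-- For `x` in a `C`-bicomodule, the identity `x₀ ⊗ f(x₁) = x₀ ⊗ f(x₋₁)` in `X ⊗ D`. -/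
def Bicomodule.IsCentral {X : Type*} [AddCommGroup X] [Module k X] (B : Bicomodule k C X)
    (f : C →ₗc[k] D) (x : X) : Prop :=
  f.toLinearMap.lTensor X (B.right.coact x) =
    TensorProduct.comm k D X (f.toLinearMap.rTensor X (B.left.coact x))

end Comodules

section Conditions

variable {k : Type u} [Field k]
variable {C : Type u} [AddCommGroup C] [Module k C] [Coalgebra k C]
variable {D : Type u} [AddCommGroup D] [Module k D] [Coalgebra k D]
variable {D' : Type u} [AddCommGroup D'] [Module k D'] [Coalgebra k D']

/-- Any two coalgebra morphisms into `C` equalized by `f` are equalized by `π`. -/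
def EqualizesPairs (f : C →ₗc[k] D) (π : C →ₗc[k] D') : Prop :=
  ∀ (C' : Type u) [AddCommGroup C'] [Module k C'] [Coalgebra k C'] (f₁ f₂ : C' →ₗc[k] C),
    f.comp f₁ = f.comp f₂ → π.comp f₁ = π.comp f₂

/-- `π` coequalizes the two projections of the pullback `C ×_D C` in the category of
coalgebras. -/
def CoequalizesPullback (f : C →ₗc[k] D) (π : C →ₗc[k] D') : Prop :=
  ∃ (P : CoalgCat.{u} k) (p₁ p₂ : P ⟶ CoalgCat.of k C),
    IsPullback p₁ p₂ (CoalgCat.ofHom f) (CoalgCat.ofHom f) ∧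
      p₁ ≫ CoalgCat.ofHom π = p₂ ≫ CoalgCat.ofHom π

/-- `π` coequalizes the two maps `id ⊗ ε, ε ⊗ id : C □_D C → C`. -/
def CoequalizesCotensor (f : C →ₗc[k] D) (π : C →ₗc[k] D') : Prop :=
  π.toLinearMap ∘ₗ idTensorCounit k C ∘ₗ (selfCotensor f).subtype =
    π.toLinearMap ∘ₗ counitTensorId k C ∘ₗ (selfCotensor f).subtype

/-- `x₀ ⊗ f(x₁) = x₀ ⊗ f(x₋₁)` implies `x₀ ⊗ π(x₁) = x₀ ⊗ π(x₋₁)` in all `C`-bicomodules. -/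
def BicomoduleCondition (f : C →ₗc[k] D) (π : C →ₗc[k] D') : Prop :=
  ∀ (X : Type u) [AddCommGroup X] [Module k X] (B : Bicomodule k C X) (x : X),
    B.IsCentral f x → B.IsCentral π x

/-- The bicomodule condition for finite-dimensional bicomodules only. -/
def FiniteBicomoduleCondition (f : C →ₗc[k] D) (π : C →ₗc[k] D') : Prop :=
  ∀ (X : Type u) [AddCommGroup X] [Module k X] [FiniteDimensional k X] (B : Bicomodule k C X)
    (x : X), B.IsCentral f x → B.IsCentral π x

/-- Linear maps of right `C`-comodules that are `D`-colinear via `f` are `D'`-colinear via `π`. -/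
def ColinearCondition (f : C →ₗc[k] D) (π : C →ₗc[k] D') : Prop :=
  ∀ (V W : Type u) [AddCommGroup V] [Module k V] [AddCommGroup W] [Module k W]
    (M : RightComodule k C V) (N : RightComodule k C W) (φ : V →ₗ[k] W),
    IsColinear (M.corestrict f) (N.corestrict f) φ →
      IsColinear (M.corestrict π) (N.corestrict π) φ

/-- The colinearity condition for finite-dimensional comodules only. -/
def FiniteColinearCondition (f : C →ₗc[k] D) (π : C →ₗc[k] D') : Prop :=
  ∀ (V W : Type u) [AddCommGroup V] [Module k V] [AddCommGroup W] [Module k W]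
    [FiniteDimensional k V] [FiniteDimensional k W]
    (M : RightComodule k C V) (N : RightComodule k C W) (φ : V →ₗ[k] W),
    IsColinear (M.corestrict f) (N.corestrict f) φ →
      IsColinear (M.corestrict π) (N.corestrict π) φ

end Conditions

end CoalgDom

/-! Condition (d) on the cotensor square C □_D C is the hub: a concrete linear-algebra statement to
which each of the others is tied.

(a), (b), (c): coequalizers of coalgebras are quotients by the coideal spanned by differences, and
`f` has a kernel pair in coalgebras (`isPullback_kernelPair`). The coequalizer of the kernel pair is
the codominion (`isCodominion_of_isPullback`), and a codominion identifies every pair that `f`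
identifies (`IsCodominion.equalizes`). The kernel pair is the colimit of all finite-dimensional
coalgebras mapping compatibly to both copies of C. Since every coalgebra is the union of its
finite-dimensional subcoalgebras, testing on these suffices; giving them underlying space k^n keeps
the indexing type in the same universe.

(d) ⇒ (b): if f f₁ = f f₂, then (f₁ ⊗ f₂)Δ takes values in C □_D C, and the two counit maps recover
f₁ and f₂.

(d) ⇒ (e), (g): both follow from `CoequalizesCotensor.lTensor_coact`. If s in W ⊗ C has the cotensor
property, then coacting on W gives an element of W ⊗ C ⊗ C whose slices along W lie in C □_D C, so
(d) applies slice by slice. Take s = x₀ ⊗ x₋₁ for (e) and s = φ(v₀) ⊗ v₁ for (g).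

(b) ⇒ (d) and (f) ⇒ (d) pass through `FunctionalCondition`, a statement about a functional λ on a
finite-dimensional bicomodule Y. From (b): y ↦ λ(y₀)y₁ − λ(y₀)y₋₁ is a coderivation Y → C, so it
gives a second coalgebra morphism C ⊕ Y → C out of the trivial extension, to be compared with the
one that kills Y. From (f): λ is an element of the dual bicomodule, and centrality of λ there is the
required identity. To reach (d), take λ = ε ⊗ ε on a finite-dimensional subbicomodule of C □_D C:
its two contractions are ε ⊗ id and id ⊗ ε.

(g) ⇒ (d): id ⊗ ε : C □_D C → C is D-colinear, and its D'-colinearity gives (d) after applying ε.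
(h) ⇒ (g) is local finiteness of comodules. -/

namespace CoalgDom

/-! ### Slicing tensors by linear functionals. -/

section Slices

variable {k : Type*} [Field k]
variable {C : Type*} [AddCommGroup C] [Module k C]
variable {V : Type*} [AddCommGroup V] [Module k V]
variable {W : Type*} [AddCommGroup W] [Module k W]

/-- The slice map `v ⊗ c ↦ α c • v`. -/
def rightSlice (α : C →ₗ[k] k) : V ⊗[k] C →ₗ[k] V :=
  (TensorProduct.rid k V).toLinearMap ∘ₗ α.lTensor V

/-- The slice map `c ⊗ v ↦ α c • v`. -/
def leftSlice (α : C →ₗ[k] k) : C ⊗[k] V →ₗ[k] V :=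
  (TensorProduct.lid k V).toLinearMap ∘ₗ α.rTensor V

@[simp]
theorem rightSlice_tmul (α : C →ₗ[k] k) (v : V) (c : C) : rightSlice α (v ⊗ₜ[k] c) = α c • v := by
  simp [rightSlice]

@[simp]
theorem leftSlice_tmul (α : C →ₗ[k] k) (v : V) (c : C) : leftSlice α (c ⊗ₜ[k] v) = α c • v := by
  simp [leftSlice]

theorem rightSlice_rTensor (α : C →ₗ[k] k) (g : V →ₗ[k] W) (t : V ⊗[k] C) :
    rightSlice α (g.rTensor C t) = g (rightSlice α t) := by
  have : rightSlice α ∘ₗ g.rTensor C = g ∘ₗ rightSlice α := by ext; simp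
  exact LinearMap.congr_fun this t

theorem leftSlice_lTensor (α : C →ₗ[k] k) (g : V →ₗ[k] W) (t : C ⊗[k] V) :
    leftSlice α (g.lTensor C t) = g (leftSlice α t) := by
  have : leftSlice α ∘ₗ g.lTensor C = g ∘ₗ leftSlice α := by ext; simp
  exact LinearMap.congr_fun this t

theorem leftSlice_comm (α : C →ₗ[k] k) (t : V ⊗[k] C) :
    leftSlice α (TensorProduct.comm k V C t) = rightSlice α t := by
  have : leftSlice α ∘ₗ (TensorProduct.comm k V C).toLinearMap = rightSlice α := by ext; simp
  exact LinearMap.congr_fun this t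

/-- The slices by the coordinate functionals of a basis of C are exactly the coefficients of t in
that basis. -/
theorem eq_zero_of_rightSlice (t : V ⊗[k] C) (h : ∀ α : C →ₗ[k] k, rightSlice α t = 0) : t = 0 := by
  classical
  let b := Module.Basis.ofVectorSpace k C
  apply (TensorProduct.equivFinsuppOfBasisRight (M := V) b).injective
  ext i
  have key : Finsupp.lapply i ∘ₗ (TensorProduct.equivFinsuppOfBasisRight (M := V) b).toLinearMap =
      rightSlice (b.coord i) := by
    ext v c; simp
  simpa using (LinearMap.congr_fun key t).trans (h _)

theorem eq_of_rightSlice (s t : V ⊗[k] C) (h : ∀ α : C →ₗ[k] k, rightSlice α s = rightSlice α t) :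
    s = t :=
  sub_eq_zero.1 (eq_zero_of_rightSlice _ fun α => by rw [map_sub, h, sub_self])

theorem eq_of_leftSlice (s t : C ⊗[k] V) (h : ∀ α : C →ₗ[k] k, leftSlice α s = leftSlice α t) :
    s = t := by
  apply (TensorProduct.comm k C V).injective
  refine eq_of_rightSlice _ _ fun α => ?_
  simpa [← leftSlice_comm] using h α

/-- By exactness of U ⊗ C → V ⊗ C → (V/U) ⊗ C, membership means vanishing in the last term, which
slices detect. This turns "the coaction restricts to U" into "U is stable under all slices". -/
theorem mem_range_rTensor_subtype (U : Submodule k V) (t : V ⊗[k] C) :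
    t ∈ LinearMap.range (U.subtype.rTensor C) ↔ ∀ α : C →ₗ[k] k, rightSlice α t ∈ U := by
  constructor
  · rintro ⟨s, rfl⟩ α
    rw [rightSlice_rTensor]
    exact (rightSlice α s).2
  · intro h
    apply (rTensor_exact C (LinearMap.exact_subtype_mkQ U) U.mkQ_surjective t).1
    refine eq_zero_of_rightSlice _ fun α => ?_
    rw [rightSlice_rTensor]
    simpa using h α

theorem mem_range_lTensor_subtype (U : Submodule k V) (t : C ⊗[k] V) :
    t ∈ LinearMap.range (U.subtype.lTensor C) ↔ ∀ α : C →ₗ[k] k, leftSlice α t ∈ U := by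
  constructor
  · rintro ⟨s, rfl⟩ α
    rw [leftSlice_lTensor]
    exact (leftSlice α s).2
  · intro h
    apply (lTensor_exact C (LinearMap.exact_subtype_mkQ U) U.mkQ_surjective t).1
    refine eq_of_leftSlice _ _ fun α => ?_
    rw [leftSlice_lTensor]
    simpa using h α

theorem exists_rTensor_lift (N : Submodule k V) (ρ : V →ₗ[k] V ⊗[k] C)
    (hN : ∀ v ∈ N, ∀ α : C →ₗ[k] k, rightSlice α (ρ v) ∈ N) :
    ∃ g : N →ₗ[k] N ⊗[k] C, N.subtype.rTensor C ∘ₗ g = ρ ∘ₗ N.subtype := by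
  -- A linear retraction onto N supplies a candidate for the restricted coaction; stability under
  -- slices makes it the right one.
  obtain ⟨p, hp⟩ := N.subtype.exists_leftInverse_of_injective N.ker_subtype
  refine ⟨p.rTensor C ∘ₗ ρ ∘ₗ N.subtype, LinearMap.ext fun v => ?_⟩
  obtain ⟨s, hs⟩ := (mem_range_rTensor_subtype N (ρ v)).2 (hN v v.2)
  simp only [LinearMap.comp_apply, Submodule.subtype_apply]
  rw [← hs, ← LinearMap.comp_apply (p.rTensor C), ← LinearMap.rTensor_comp, hp]
  simp

theorem exists_lTensor_lift (N : Submodule k V) (ρ : V →ₗ[k] C ⊗[k] V)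
    (hN : ∀ v ∈ N, ∀ α : C →ₗ[k] k, leftSlice α (ρ v) ∈ N) :
    ∃ g : N →ₗ[k] C ⊗[k] N, N.subtype.lTensor C ∘ₗ g = ρ ∘ₗ N.subtype := by
  obtain ⟨p, hp⟩ := N.subtype.exists_leftInverse_of_injective N.ker_subtype
  refine ⟨p.lTensor C ∘ₗ ρ ∘ₗ N.subtype, LinearMap.ext fun v => ?_⟩
  obtain ⟨s, hs⟩ := (mem_range_lTensor_subtype N (ρ v)).2 (hN v v.2)
  simp only [LinearMap.comp_apply, Submodule.subtype_apply]
  rw [← hs, ← LinearMap.comp_apply (p.lTensor C), ← LinearMap.lTensor_comp, hp]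
  simp

end Slices

/-! ### Subcomodules and subbicomodules. -/

section Restriction

variable {k : Type*} [Field k]
variable {C : Type*} [AddCommGroup C] [Module k C] [Coalgebra k C]
variable {V : Type*} [AddCommGroup V] [Module k V]
variable {U : Type*} [AddCommGroup U] [Module k U]

/-- A linear map `g` that is compatible with the coaction of a right comodule `V` along an
injection `U → V` makes `U` a right comodule. -/
def RightComodule.ofInjective (M : RightComodule k C V) (i : U →ₗ[k] V)
    (hi : Function.Injective i) (g : U →ₗ[k] U ⊗[k] C)
    (hg : i.rTensor C ∘ₗ g = M.coact ∘ₗ i) : RightComodule k C U where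
  coact := g
  coassoc := by
    -- Tensoring over a field preserves injectivity, so the axioms may be checked after embedding
    -- into V, where they hold.
    have hi' : Function.Injective (i.rTensor (C ⊗[k] C)) :=
      Module.Flat.rTensor_preserves_injective_linearMap i hi
    have h1 : i.rTensor (C ⊗[k] C) ∘ₗ (TensorProduct.assoc k U C C).toLinearMap =
        (TensorProduct.assoc k V C C).toLinearMap ∘ₗ (i.rTensor C).rTensor C := by
      ext; simp
    have h2 : i.rTensor (C ⊗[k] C) ∘ₗ (Coalgebra.comul (R := k) (A := C)).lTensor U =
        (Coalgebra.comul (R := k) (A := C)).lTensor V ∘ₗ i.rTensor C := by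
      ext; simp
    ext u
    apply hi'
    have a1 := LinearMap.congr_fun h1 (g.rTensor C (g u))
    have a2 := LinearMap.congr_fun h2 (g u)
    have a3 := LinearMap.congr_fun hg u
    have a4 := LinearMap.congr_fun M.coassoc (i u)
    simp only [LinearMap.comp_apply, LinearEquiv.coe_coe] at a1 a2 a3 a4 ⊢
    rw [a1, a2, a3, ← a4, ← LinearMap.comp_apply, ← LinearMap.rTensor_comp, hg,
      LinearMap.rTensor_comp, LinearMap.comp_apply, a3]
  counit := by
    have hi' : Function.Injective (i.rTensor k) :=
      Module.Flat.rTensor_preserves_injective_linearMap i hi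
    have h2 : i.rTensor k ∘ₗ (Coalgebra.counit (R := k) (A := C)).lTensor U =
        (Coalgebra.counit (R := k) (A := C)).lTensor V ∘ₗ i.rTensor C := by
      ext; simp
    ext u
    apply hi'
    have a2 := LinearMap.congr_fun h2 (g u)
    have a3 := LinearMap.congr_fun hg u
    have a4 := LinearMap.congr_fun M.counit (i u)
    simp only [LinearMap.comp_apply] at a2 a3 a4 ⊢
    rw [a2, a3, a4]
    simp

/-- A linear map `g` that is compatible with the coaction of a left comodule `V` along an
injection `U → V` makes `U` a left comodule. -/
def LeftComodule.ofInjective (M : LeftComodule k C V) (i : U →ₗ[k] V)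
    (hi : Function.Injective i) (g : U →ₗ[k] C ⊗[k] U)
    (hg : i.lTensor C ∘ₗ g = M.coact ∘ₗ i) : LeftComodule k C U where
  coact := g
  coassoc := by
    have hi' : Function.Injective ((i.lTensor C).lTensor C) :=
      Module.Flat.lTensor_preserves_injective_linearMap _
        (Module.Flat.lTensor_preserves_injective_linearMap i hi)
    have h1 : (i.lTensor C).lTensor C ∘ₗ (TensorProduct.assoc k C C U).toLinearMap =
        (TensorProduct.assoc k C C V).toLinearMap ∘ₗ i.lTensor (C ⊗[k] C) := by
      ext; simp
    have h2 : i.lTensor (C ⊗[k] C) ∘ₗ (Coalgebra.comul (R := k) (A := C)).rTensor U =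
        (Coalgebra.comul (R := k) (A := C)).rTensor V ∘ₗ i.lTensor C := by
      ext; simp
    ext u
    apply hi'
    have a1 := LinearMap.congr_fun h1 ((Coalgebra.comul (R := k) (A := C)).rTensor U (g u))
    have a2 := LinearMap.congr_fun h2 (g u)
    have a3 := LinearMap.congr_fun hg u
    have a4 := LinearMap.congr_fun M.coassoc (i u)
    simp only [LinearMap.comp_apply, LinearEquiv.coe_coe] at a1 a2 a3 a4 ⊢
    rw [a1, a2, a3, a4, ← LinearMap.comp_apply (LinearMap.lTensor C (LinearMap.lTensor C i)),
      ← LinearMap.lTensor_comp, hg, LinearMap.lTensor_comp, LinearMap.comp_apply, a3]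
  counit := by
    have hi' : Function.Injective (i.lTensor k) :=
      Module.Flat.lTensor_preserves_injective_linearMap i hi
    have h2 : i.lTensor k ∘ₗ (Coalgebra.counit (R := k) (A := C)).rTensor U =
        (Coalgebra.counit (R := k) (A := C)).rTensor V ∘ₗ i.lTensor C := by
      ext; simp
    ext u
    apply hi'
    have a2 := LinearMap.congr_fun h2 (g u)
    have a3 := LinearMap.congr_fun hg u
    have a4 := LinearMap.congr_fun M.counit (i u)
    simp only [LinearMap.comp_apply] at a2 a3 a4 ⊢
    rw [a2, a3, a4]
    simp

/-- Linear maps that are compatible with the coactions of a bicomodule `V` along an injection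
`U → V` make `U` a bicomodule. -/
def Bicomodule.ofInjective (B : Bicomodule k C V) (i : U →ₗ[k] V)
    (hi : Function.Injective i) (g : U →ₗ[k] C ⊗[k] U) (h : U →ₗ[k] U ⊗[k] C)
    (hg : i.lTensor C ∘ₗ g = B.left.coact ∘ₗ i)
    (hh : i.rTensor C ∘ₗ h = B.right.coact ∘ₗ i) : Bicomodule k C U where
  left := B.left.ofInjective i hi g hg
  right := B.right.ofInjective i hi h hh
  comm := by
    have hi' : Function.Injective ((i.rTensor C).lTensor C) :=
      Module.Flat.lTensor_preserves_injective_linearMap _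
        (Module.Flat.rTensor_preserves_injective_linearMap i hi)
    have h1 : (i.rTensor C).lTensor C ∘ₗ (TensorProduct.assoc k C U C).toLinearMap =
        (TensorProduct.assoc k C V C).toLinearMap ∘ₗ (i.lTensor C).rTensor C := by
      ext; simp
    ext u
    apply hi'
    have a1 := LinearMap.congr_fun h1 (g.rTensor C (h u))
    have a2 := LinearMap.congr_fun hg u
    have a3 := LinearMap.congr_fun hh u
    have a4 := LinearMap.congr_fun B.comm (i u)
    simp only [LeftComodule.ofInjective, RightComodule.ofInjective, LinearMap.comp_apply,
      LinearEquiv.coe_coe] at a1 a2 a3 a4 ⊢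
    rw [a1, ← LinearMap.comp_apply (LinearMap.rTensor C (LinearMap.lTensor C i)),
      ← LinearMap.rTensor_comp, hg, LinearMap.rTensor_comp, LinearMap.comp_apply, a3, a4,
      ← LinearMap.comp_apply (LinearMap.lTensor C (LinearMap.rTensor C i)),
      ← LinearMap.lTensor_comp, hh, LinearMap.lTensor_comp, LinearMap.comp_apply, a2]

theorem RightComodule.exists_restrict (M : RightComodule k C V) (N : Submodule k V)
    (hN : ∀ v ∈ N, ∀ α : C →ₗ[k] k, rightSlice α (M.coact v) ∈ N) :
    ∃ M' : RightComodule k C N, N.subtype.rTensor C ∘ₗ M'.coact = M.coact ∘ₗ N.subtype := by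
  obtain ⟨g, hg⟩ := exists_rTensor_lift N M.coact hN
  exact ⟨M.ofInjective _ N.injective_subtype g hg, hg⟩

theorem Bicomodule.exists_restrict (B : Bicomodule k C V) (N : Submodule k V)
    (hr : ∀ v ∈ N, ∀ α : C →ₗ[k] k, rightSlice α (B.right.coact v) ∈ N)
    (hl : ∀ v ∈ N, ∀ α : C →ₗ[k] k, leftSlice α (B.left.coact v) ∈ N) :
    ∃ B' : Bicomodule k C N, N.subtype.rTensor C ∘ₗ B'.right.coact = B.right.coact ∘ₗ N.subtype ∧
      N.subtype.lTensor C ∘ₗ B'.left.coact = B.left.coact ∘ₗ N.subtype := by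
  obtain ⟨g, hg⟩ := exists_rTensor_lift N B.right.coact hr
  obtain ⟨h, hh⟩ := exists_lTensor_lift N B.left.coact hl
  exact ⟨B.ofInjective _ N.injective_subtype h g hh hg, hg, hh⟩

end Restriction

/-! ### Local finiteness of comodules and bicomodules. -/

section Finiteness

variable {k : Type*} [Field k]
variable {C : Type*} [AddCommGroup C] [Module k C] [Coalgebra k C]
variable {V : Type*} [AddCommGroup V] [Module k V]

theorem RightComodule.rightSlice_counit (M : RightComodule k C V) (v : V) :
    rightSlice Coalgebra.counit (M.coact v) = v := by
  have := LinearMap.congr_fun M.counit v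
  simp only [LinearMap.comp_apply] at this
  simp [rightSlice, this]

theorem LeftComodule.leftSlice_counit (M : LeftComodule k C V) (v : V) :
    leftSlice Coalgebra.counit (M.coact v) = v := by
  have := LinearMap.congr_fun M.counit v
  simp only [LinearMap.comp_apply] at this
  simp [leftSlice, this]

/-- Coassociativity in dual form: the functionals on C act on V by v ↦ α(v₁)v₀, and composing two
actions is acting by a convolution product. A subspace defined by quantifying over all functionals
is therefore automatically stable. -/
theorem RightComodule.rightSlice_rightSlice (M : RightComodule k C V) (α β : C →ₗ[k] k) (v : V) :
    rightSlice β (M.coact (rightSlice α (M.coact v))) =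
      rightSlice (LinearMap.mul' k k ∘ₗ TensorProduct.map β α ∘ₗ Coalgebra.comul) (M.coact v) := by
  have h1 : rightSlice β ∘ₗ M.coact ∘ₗ rightSlice α =
      (rightSlice (LinearMap.mul' k k ∘ₗ TensorProduct.map β α) ∘ₗ
        (TensorProduct.assoc k V C C).toLinearMap) ∘ₗ M.coact.rTensor C := by
    ext v c
    simp only [TensorProduct.AlgebraTensorModule.curry_apply, LinearMap.restrictScalars_self,
      TensorProduct.curry_apply, LinearMap.comp_apply, LinearMap.rTensor_tmul, rightSlice_tmul,
      map_smul, LinearEquiv.coe_coe]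
    generalize M.coact v = t
    induction t with
    | zero => simp
    | tmul x y => simp [smul_smul, mul_comm]
    | add x y hx hy => simp only [map_add, TensorProduct.add_tmul, hx, hy, smul_add]
  have h2 : rightSlice (V := V) (LinearMap.mul' k k ∘ₗ TensorProduct.map β α) ∘ₗ
      (Coalgebra.comul (R := k) (A := C)).lTensor V =
      rightSlice (LinearMap.mul' k k ∘ₗ TensorProduct.map β α ∘ₗ Coalgebra.comul) := by
    ext; simp
  have a1 := LinearMap.congr_fun h1 (M.coact v)
  have a3 := LinearMap.congr_fun M.coassoc v
  simp only [LinearMap.comp_apply, LinearEquiv.coe_coe] at a1 a3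
  rw [a1, a3, ← h2, LinearMap.comp_apply]

theorem LeftComodule.leftSlice_leftSlice (M : LeftComodule k C V) (α β : C →ₗ[k] k) (v : V) :
    leftSlice β (M.coact (leftSlice α (M.coact v))) =
      leftSlice (LinearMap.mul' k k ∘ₗ TensorProduct.map α β ∘ₗ Coalgebra.comul) (M.coact v) := by
  have h1 : leftSlice β ∘ₗ M.coact ∘ₗ leftSlice α =
      leftSlice α ∘ₗ (leftSlice β ∘ₗ M.coact).lTensor C := by
    ext; simp
  have h2 : leftSlice α ∘ₗ (leftSlice β).lTensor C ∘ₗ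
        (TensorProduct.assoc k C C V).toLinearMap ∘ₗ
      (Coalgebra.comul (R := k) (A := C)).rTensor V =
      leftSlice (LinearMap.mul' k k ∘ₗ TensorProduct.map α β ∘ₗ Coalgebra.comul) := by
    ext c v
    simp only [TensorProduct.AlgebraTensorModule.curry_apply, LinearMap.restrictScalars_self,
      TensorProduct.curry_apply, LinearMap.comp_apply, LinearMap.rTensor_tmul, leftSlice_tmul,
      LinearEquiv.coe_coe]
    generalize Coalgebra.comul (R := k) c = t
    induction t with
    | zero => simp
    | tmul x y => simp [smul_smul, mul_comm]
    | add x y hx hy => simp only [map_add, TensorProduct.add_tmul, hx, hy, add_smul]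
  have a1 := LinearMap.congr_fun h1 (M.coact v)
  have a3 := LinearMap.congr_fun M.coassoc v
  simp only [LinearMap.comp_apply, LinearEquiv.coe_coe, LinearMap.lTensor_comp] at a1 a3
  rw [a1, ← a3, ← h2]
  rfl

/-- This is the compatibility axiom `comm` in dual form: the actions of functionals from the two
sides commute. -/
theorem Bicomodule.rightSlice_leftSlice (B : Bicomodule k C V) (α β : C →ₗ[k] k) (v : V) :
    rightSlice β (B.right.coact (leftSlice α (B.left.coact v))) =
      leftSlice α (B.left.coact (rightSlice β (B.right.coact v))) := by
  have h1 : rightSlice β ∘ₗ leftSlice α ∘ₗ (TensorProduct.assoc k C V C).toLinearMap =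
      leftSlice (V := V) α ∘ₗ rightSlice β := by
    ext; simp [smul_smul, mul_comm, TensorProduct.smul_tmul']
  have a1 := LinearMap.congr_fun h1 (B.left.coact.rTensor C (B.right.coact v))
  have a3 := LinearMap.congr_fun B.comm v
  simp only [LinearMap.comp_apply, LinearEquiv.coe_coe] at a1 a3
  rw [a3, rightSlice_rTensor, leftSlice_lTensor] at a1
  exact a1

/-- Every finite subset of a right comodule lies in a finite-dimensional subcomodule. -/
theorem RightComodule.exists_finite_closed (M : RightComodule k C V) (s : Set V) (hs : s.Finite) :
    ∃ N : Submodule k V, Module.Finite k N ∧ s ⊆ N ∧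
      ∀ v ∈ N, ∀ α : C →ₗ[k] k, rightSlice α (M.coact v) ∈ N := by
  obtain ⟨U, hU, hsU⟩ :=
    TensorProduct.exists_finite_submodule_left_of_setFinite (M.coact '' s) (hs.image _)
  -- N is the largest stable subspace of U: evaluating at the counit gives N ≤ U, hence finiteness,
  -- and the convolution formula gives stability.
  let N : Submodule k V := ⨅ α : C →ₗ[k] k, U.comap (rightSlice α ∘ₗ M.coact)
  have hmem : ∀ v, v ∈ N ↔ ∀ α : C →ₗ[k] k, rightSlice α (M.coact v) ∈ U := by
    intro v; simp [N, Submodule.mem_iInf]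
  refine ⟨N, ?_, ?_, ?_⟩
  · refine Submodule.finiteDimensional_of_le (S₂ := U) fun v hv => ?_
    simpa [M.rightSlice_counit] using (hmem v).1 hv Coalgebra.counit
  · intro v hv
    exact (hmem v).2 ((mem_range_rTensor_subtype U _).1 (hsU ⟨v, hv, rfl⟩))
  · intro v hv α
    refine (hmem _).2 fun β => ?_
    rw [M.rightSlice_rightSlice]
    exact (hmem v).1 hv _

/-- Every finite subset of a bicomodule lies in a finite-dimensional subbicomodule. -/
theorem Bicomodule.exists_finite_closed (B : Bicomodule k C V) (s : Set V) (hs : s.Finite) :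
    ∃ N : Submodule k V, Module.Finite k N ∧ s ⊆ N ∧
      (∀ v ∈ N, ∀ α : C →ₗ[k] k, rightSlice α (B.right.coact v) ∈ N) ∧
      ∀ v ∈ N, ∀ α : C →ₗ[k] k, leftSlice α (B.left.coact v) ∈ N := by
  obtain ⟨U, hU, hsU, hr⟩ := B.right.exists_finite_closed s hs
  obtain ⟨t, ht⟩ : ∃ t : Finset V, Submodule.span k t = U :=
    (Submodule.fg_iff_finiteDimensional U).2 hU
  obtain ⟨W, hW, htW⟩ := TensorProduct.exists_finite_submodule_right_of_setFinite
    (B.left.coact '' (t : Set V)) (t.finite_toSet.image _)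
  have hUW : ∀ v ∈ U, ∀ α : C →ₗ[k] k, leftSlice α (B.left.coact v) ∈ W := by
    intro v hv α
    have : U ≤ W.comap (leftSlice α ∘ₗ B.left.coact) := by
      rw [← ht, Submodule.span_le]
      intro x hx
      exact (mem_range_lTensor_subtype W _).1 (htW ⟨x, hx, rfl⟩) α
    exact this hv
  -- The same device with two-sided slices. U bounds the right slices of s and W bounds the left
  -- slices of U, so s lies in N; taking both functionals to be the counit gives N ≤ W.
  let N : Submodule k V := ⨅ α : C →ₗ[k] k, ⨅ β : C →ₗ[k] k,
    W.comap (leftSlice α ∘ₗ B.left.coact ∘ₗ rightSlice β ∘ₗ B.right.coact)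
  have hmem : ∀ v, v ∈ N ↔ ∀ α β : C →ₗ[k] k,
      leftSlice α (B.left.coact (rightSlice β (B.right.coact v))) ∈ W := by
    intro v; simp [N, Submodule.mem_iInf]
  refine ⟨N, ?_, ?_, ?_, ?_⟩
  · refine Submodule.finiteDimensional_of_le (S₂ := W) fun v hv => ?_
    simpa [B.right.rightSlice_counit, B.left.leftSlice_counit] using
      (hmem v).1 hv Coalgebra.counit Coalgebra.counit
  · intro v hv
    exact (hmem v).2 fun α β => hUW _ (hr _ (hsU hv) _) _
  · intro v hv β
    refine (hmem _).2 fun α γ => ?_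
    rw [B.right.rightSlice_rightSlice]
    exact (hmem v).1 hv _ _
  · intro v hv α
    refine (hmem _).2 fun γ β => ?_
    rw [B.rightSlice_leftSlice, B.left.leftSlice_leftSlice]
    exact (hmem v).1 hv _ _

end Finiteness

/-! ### Finite-dimensional subcoalgebras and factorization through them. -/

section Subcoalgebras

variable {k : Type*} [Field k]

/-- A linear map `g` that is compatible with the comultiplication of `Q` along an injection
`i : E → Q` makes `E` a coalgebra. -/
abbrev coalgebraOfInjective {E Q : Type*} [AddCommGroup E] [Module k E] [AddCommGroup Q]
    [Module k Q] [Coalgebra k Q] (i : E →ₗ[k] Q) (hi : Function.Injective i) (g : E →ₗ[k] E ⊗[k] E)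
    (hg : TensorProduct.map i i ∘ₗ g = Coalgebra.comul ∘ₗ i) : Coalgebra k E where
  comul := g
  counit := Coalgebra.counit ∘ₗ i
  coassoc := by
    have hi' : Function.Injective (TensorProduct.map i (TensorProduct.map i i)) :=
      TensorProduct.map_injective_of_flat_flat _ _ hi
        (TensorProduct.map_injective_of_flat_flat _ _ hi hi)
    have h1 : TensorProduct.map i (TensorProduct.map i i) ∘ₗ
        (TensorProduct.assoc k E E E).toLinearMap = (TensorProduct.assoc k Q Q Q).toLinearMap ∘ₗ
          TensorProduct.map (TensorProduct.map i i) i := by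
      ext; simp
    have h2 : TensorProduct.map (TensorProduct.map i i) i ∘ₗ g.rTensor E =
        (Coalgebra.comul (R := k) (A := Q)).rTensor Q ∘ₗ TensorProduct.map i i := by
      rw [LinearMap.map_comp_rTensor, LinearMap.rTensor_comp_map, hg]
    have h3 : TensorProduct.map i (TensorProduct.map i i) ∘ₗ g.lTensor E =
        (Coalgebra.comul (R := k) (A := Q)).lTensor Q ∘ₗ TensorProduct.map i i := by
      rw [LinearMap.map_comp_lTensor, LinearMap.lTensor_comp_map, hg]
    ext x
    apply hi'
    have a1 := LinearMap.congr_fun h1 (g.rTensor E (g x))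
    have a2 := LinearMap.congr_fun h2 (g x)
    have a3 := LinearMap.congr_fun h3 (g x)
    have a4 := LinearMap.congr_fun hg x
    have a5 := LinearMap.congr_fun (Coalgebra.coassoc (R := k) (A := Q)) (i x)
    simp only [LinearMap.comp_apply, LinearEquiv.coe_coe] at a1 a2 a3 a4 a5 ⊢
    rw [a1, a2, a3, a4, a5]
  rTensor_counit_comp_comul := by
    have hi' : Function.Injective (i.lTensor k) :=
      Module.Flat.lTensor_preserves_injective_linearMap i hi
    ext x
    apply hi'
    have h : i.lTensor k ∘ₗ (Coalgebra.counit ∘ₗ i).rTensor E =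
        (Coalgebra.counit (R := k) (A := Q)).rTensor Q ∘ₗ TensorProduct.map i i := by
      ext; simp
    have a1 := LinearMap.congr_fun h (g x)
    have a4 := LinearMap.congr_fun hg x
    simp only [LinearMap.comp_apply] at a1 a4 ⊢
    rw [a1, a4]
    simp
  lTensor_counit_comp_comul := by
    have hi' : Function.Injective (i.rTensor k) :=
      Module.Flat.rTensor_preserves_injective_linearMap i hi
    ext x
    apply hi'
    have h : i.rTensor k ∘ₗ (Coalgebra.counit ∘ₗ i).lTensor E =
        (Coalgebra.counit (R := k) (A := Q)).lTensor Q ∘ₗ TensorProduct.map i i := by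
      ext; simp
    have a1 := LinearMap.congr_fun h (g x)
    have a4 := LinearMap.congr_fun hg x
    simp only [LinearMap.comp_apply] at a1 a4 ⊢
    rw [a1, a4]
    simp

variable (k) in
/-- The space `k ^ n`, without its product coalgebra structure. -/
def Coord (n : ℕ) : Type _ := Fin n → k

instance (n : ℕ) : AddCommGroup (Coord k n) := inferInstanceAs (AddCommGroup (Fin n → k))

instance (n : ℕ) : Module k (Coord k n) := inferInstanceAs (Module k (Fin n → k))

instance (n : ℕ) : Module.Finite k (Coord k n) := inferInstanceAs (Module.Finite k (Fin n → k))

variable (k) in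
/-- A coalgebra structure on some `k ^ n`. -/
structure FinCoalg where
  dim : ℕ
  coalgebra : Coalgebra k (Coord k dim)

/-- The underlying space of a finite-dimensional coalgebra. -/
def FinCoalg.Carrier (F : FinCoalg k) : Type _ := Coord k F.dim

instance (F : FinCoalg k) : AddCommGroup F.Carrier := inferInstanceAs (AddCommGroup (Coord k F.dim))

instance (F : FinCoalg k) : Module k F.Carrier := inferInstanceAs (Module k (Coord k F.dim))

instance (F : FinCoalg k) : Module.Finite k F.Carrier :=
  inferInstanceAs (Module.Finite k (Coord k F.dim))

instance (F : FinCoalg k) : Coalgebra k F.Carrier := F.coalgebra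

variable {Q : Type*} [AddCommGroup Q] [Module k Q] [Coalgebra k Q]

variable (k Q) in
/-- A coalgebra as a bicomodule over itself. -/
def Bicomodule.regular : Bicomodule k Q Q where
  left := LeftComodule.regular k Q
  right := RightComodule.regular k Q
  comm := Coalgebra.coassoc

/-- The fundamental theorem of coalgebras: every finite subset of a coalgebra lies in a
finite-dimensional subcoalgebra. -/
theorem exists_finite_subcoalgebra (s : Set Q) (hs : s.Finite) :
    ∃ (F : FinCoalg k) (h : F.Carrier →ₗc[k] Q),
      Function.Injective h ∧ s ⊆ Set.range h := by
  obtain ⟨N, hN, hsN, hr, hl⟩ := (Bicomodule.regular k Q).exists_finite_closed s hs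
  obtain ⟨p, hp⟩ := N.subtype.exists_leftInverse_of_injective N.ker_subtype
  -- The subcoalgebra is moved onto a coordinate space, so that finite-dimensional coalgebras can be
  -- indexed in the universe of k.
  let e : Coord k (Module.finrank k N) ≃ₗ[k] N := (Module.finBasis k N).equivFun.symm
  let i : Coord k (Module.finrank k N) →ₗ[k] Q := N.subtype ∘ₗ e.toLinearMap
  let r : Q →ₗ[k] Coord k (Module.finrank k N) := e.symm.toLinearMap ∘ₗ p
  have hi : Function.Injective i := N.injective_subtype.comp e.injective
  have hir : i ∘ₗ r = N.subtype ∘ₗ p := by ext; simp [i, r]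
  have hpN : (N.subtype ∘ₗ p) ∘ₗ N.subtype = N.subtype := by
    rw [LinearMap.comp_assoc, hp, LinearMap.comp_id]
  -- N is stable on both sides, so Δ(i x) lies in N ⊗ Q and in Q ⊗ N; projecting onto N in either
  -- leg leaves it unchanged.
  have hg : TensorProduct.map i i ∘ₗ (TensorProduct.map r r ∘ₗ Coalgebra.comul ∘ₗ i) =
      Coalgebra.comul ∘ₗ i := by
    ext x
    obtain ⟨y, hy⟩ := (mem_range_rTensor_subtype N _).2 (hr (i x) (e x).2)
    obtain ⟨z, hz⟩ := (mem_range_lTensor_subtype N _).2 (hl (i x) (e x).2)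
    change N.subtype.rTensor Q y = Coalgebra.comul (i x) at hy
    change N.subtype.lTensor Q z = Coalgebra.comul (i x) at hz
    have h1 : (N.subtype ∘ₗ p).rTensor Q (Coalgebra.comul (i x)) = Coalgebra.comul (i x) := by
      rw [← hy, ← LinearMap.comp_apply, ← LinearMap.rTensor_comp, hpN]
    have h2 : (N.subtype ∘ₗ p).lTensor Q (Coalgebra.comul (i x)) = Coalgebra.comul (i x) := by
      rw [← hz, ← LinearMap.comp_apply, ← LinearMap.lTensor_comp, hpN]
    simp only [LinearMap.comp_apply]
    rw [← LinearMap.comp_apply (TensorProduct.map i i), ← TensorProduct.map_comp, hir,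
      ← LinearMap.rTensor_comp_lTensor, LinearMap.comp_apply, h2, h1]
  refine ⟨⟨_, coalgebraOfInjective i hi _ hg⟩, ⟨i, rfl, hg⟩, hi,
    fun x hx => ⟨e.symm ⟨x, hsN hx⟩, ?_⟩⟩
  change N.subtype (e (e.symm _)) = x
  simp

/-- A coalgebra morphism into `Q` whose image lies in that of an injective coalgebra morphism
factors through the latter. -/
theorem exists_factor_of_range_subset {E F : Type*} [AddCommGroup E] [Module k E] [Coalgebra k E]
    [AddCommGroup F] [Module k F] [Coalgebra k F] (g : E →ₗc[k] Q) (h : F →ₗc[k] Q)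
    (hh : Function.Injective h) (hr : Set.range g ⊆ Set.range h) :
    ∃ s : E →ₗc[k] F, h.comp s = g := by
  -- A merely linear retraction p of h is enough: p ∘ g becomes a coalgebra morphism because h ⊗ h
  -- is injective and can be cancelled.
  obtain ⟨p, hp⟩ := h.toLinearMap.exists_leftInverse_of_injective (LinearMap.ker_eq_bot.2 hh)
  have key : h.toLinearMap ∘ₗ p ∘ₗ g.toLinearMap = g.toLinearMap := by
    ext x
    obtain ⟨y, hy⟩ := hr ⟨x, rfl⟩
    change h.toLinearMap y = g.toLinearMap x at hy
    simp only [LinearMap.comp_apply]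
    rw [← hy, ← LinearMap.comp_apply p, hp, LinearMap.id_apply]
  have hinj := TensorProduct.map_injective_of_flat_flat h.toLinearMap h.toLinearMap hh hh
  refine ⟨⟨p ∘ₗ g.toLinearMap, ?_, ?_⟩, CoalgHom.ext fun x => LinearMap.congr_fun key x⟩
  · rw [← h.counit_comp, LinearMap.comp_assoc, key, g.counit_comp]
  · apply LinearMap.cancel_left hinj |>.1
    rw [← LinearMap.comp_assoc, ← TensorProduct.map_comp, key, g.map_comp_comul,
      ← LinearMap.comp_assoc, h.map_comp_comul, LinearMap.comp_assoc, key]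

end Subcoalgebras

/-! ### Coideals generated by differences of morphisms. -/

section Coequalizers

variable {k : Type*} [Field k]
variable {Q : Type*} [AddCommGroup Q] [Module k Q] [Coalgebra k Q]
variable {J : Type*} {E : J → Type*} [∀ j, AddCommGroup (E j)] [∀ j, Module k (E j)]
  [∀ j, Coalgebra k (E j)]

/-- The sum of the images of the differences of a family of pairs of coalgebra morphisms. -/
def coequalizingCoideal (g h : ∀ j, E j →ₗc[k] Q) : Submodule k Q :=
  ⨆ j, LinearMap.range ((g j).toLinearMap - (h j).toLinearMap)

theorem coequalizingCoideal_le_ker {g h : ∀ j, E j →ₗc[k] Q} {W : Type*} [AddCommGroup W]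
    [Module k W] {q : Q →ₗ[k] W} (hq : ∀ j x, q (g j x) = q (h j x)) :
    coequalizingCoideal g h ≤ LinearMap.ker q := by
  refine iSup_le fun j => ?_
  rintro _ ⟨x, rfl⟩
  rw [LinearMap.mem_ker, LinearMap.sub_apply, map_sub, sub_eq_zero]
  exact hq j x

theorem mkQ_coequalizingCoideal (g h : ∀ j, E j →ₗc[k] Q) (j : J) (x : E j) :
    (coequalizingCoideal g h).mkQ (g j x) = (coequalizingCoideal g h).mkQ (h j x) := by
  rw [← sub_eq_zero, ← map_sub, Submodule.mkQ_apply, Submodule.Quotient.mk_eq_zero]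
  exact Submodule.mem_iSup_of_mem j ⟨x, rfl⟩

/-- Modulo the subspace, g and h agree; hence so do (g ⊗ g)Δ and (h ⊗ h)Δ, that is, Δg and Δh have
the same image in the tensor square of the quotient. -/
instance (g h : ∀ j, E j →ₗc[k] Q) : (coequalizingCoideal g h).IsCoideal where
  counit_eq_zero := coequalizingCoideal_le_ker fun j x => by simp
  map_mkQ_comul_eq_zero := by
    refine coequalizingCoideal_le_ker (q := TensorProduct.map (coequalizingCoideal g h).mkQ
      (coequalizingCoideal g h).mkQ ∘ₗ Coalgebra.comul) fun j x => ?_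
    have hmk : (coequalizingCoideal g h).mkQ ∘ₗ (g j).toLinearMap =
        (coequalizingCoideal g h).mkQ ∘ₗ (h j).toLinearMap :=
      LinearMap.ext (mkQ_coequalizingCoideal g h j)
    have a1 := LinearMap.congr_fun (g j).map_comp_comul x
    have a2 := LinearMap.congr_fun (h j).map_comp_comul x
    simp only [LinearMap.comp_apply] at a1 a2
    change TensorProduct.map _ _ (Coalgebra.comul ((g j).toLinearMap x)) =
      TensorProduct.map _ _ (Coalgebra.comul ((h j).toLinearMap x))
    rw [← a1, ← a2, TensorProduct.map_map, TensorProduct.map_map, hmk]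

/-- A coalgebra morphism that kills a coideal factors through the quotient. -/
def quotientLift {I : Submodule k Q} [I.IsCoideal] {W : Type*} [AddCommGroup W] [Module k W]
    [Coalgebra k W] (q : Q →ₗc[k] W) (hI : I ≤ LinearMap.ker q.toLinearMap) :
    (Q ⧸ I) →ₗc[k] W where
  __ := I.liftQ q.toLinearMap hI
  counit_comp := by
    apply I.linearMap_qext
    rw [LinearMap.comp_assoc, I.liftQ_mkQ, q.counit_comp, Coalgebra.Quotient.counit_comp_mkQ]
  map_comp_comul := by
    apply I.linearMap_qext
    rw [LinearMap.comp_assoc, Coalgebra.Quotient.comul_comp_mkQ, ← LinearMap.comp_assoc,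
      ← TensorProduct.map_comp, I.liftQ_mkQ, q.map_comp_comul, LinearMap.comp_assoc, I.liftQ_mkQ]

end Coequalizers

/-! ### Direct sums of coalgebras. -/

section DirectSums

variable {k : Type*} [Field k] {ι : Type*} [DecidableEq ι] {A : ι → Type*}
  [∀ i, AddCommGroup (A i)] [∀ i, Module k (A i)] [∀ i, Coalgebra k (A i)]

variable (k A) in
/-- The inclusion of a summand into a direct sum of coalgebras. -/
def sumSingle (i : ι) : A i →ₗc[k] Π₀ i, A i where
  __ := DFinsupp.lsingle i
  counit_comp := DFinsupp.counit_comp_lsingle k ι A i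
  map_comp_comul := (DFinsupp.comul_comp_lsingle k ι A i).symm

/-- The morphism out of a direct sum of coalgebras given by a family of morphisms. -/
def sumDesc {C : Type*} [AddCommGroup C] [Module k C] [Coalgebra k C]
    (g : ∀ i, A i →ₗc[k] C) : (Π₀ i, A i) →ₗc[k] C where
  __ := DFinsupp.lsum k fun i => (g i).toLinearMap
  counit_comp := by
    ext i x
    simp
  map_comp_comul := by
    ext i x
    have h := LinearMap.congr_fun (g i).map_comp_comul x
    simp only [LinearMap.comp_apply] at h
    have h2 : (DFinsupp.lsum k fun i => (g i).toLinearMap) ∘ₗ DFinsupp.lsingle i =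
        (g i).toLinearMap := by
      ext; simp
    simp only [LinearMap.comp_apply, DFinsupp.lsingle_apply, DFinsupp.comul_single]
    rw [TensorProduct.map_map, h2, h]
    simp

theorem sumDesc_sumSingle {C : Type*} [AddCommGroup C] [Module k C] [Coalgebra k C]
    (g : ∀ i, A i →ₗc[k] C) (i : ι) (x : A i) : sumDesc g (sumSingle k A i x) = g i x := by
  change (DFinsupp.lsum k fun i => (g i).toLinearMap) (DFinsupp.single i x) = g i x
  simp

end DirectSums

/-! ### The kernel pair as a colimit of finite-dimensional test coalgebras. -/

noncomputable section KernelPair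

variable {k : Type u} [Field k]
variable {C : Type u} [AddCommGroup C] [Module k C] [Coalgebra k C]
variable {D : Type u} [AddCommGroup D] [Module k D] [Coalgebra k D]

/-- A finite-dimensional coalgebra with two morphisms to `C` that are equalized by `f`. -/
structure FinPair (f : C →ₗc[k] D) where
  base : FinCoalg k
  fst : base.Carrier →ₗc[k] C
  snd : base.Carrier →ₗc[k] C
  w : f.comp fst = f.comp snd

variable {f : C →ₗc[k] D}

instance : DecidableEq (FinPair f) := Classical.decEq _

/-- Morphisms of test pairs. -/
structure FinPair.Hom (i j : FinPair f) where
  hom : i.base.Carrier →ₗc[k] j.base.Carrier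
  fst_comp : j.fst.comp hom = i.fst
  snd_comp : j.snd.comp hom = i.snd

/-- The inclusion of a test coalgebra into the direct sum of all of them. -/
def FinPair.single (j : FinPair f) : j.base.Carrier →ₗc[k] Π₀ i : FinPair f, i.base.Carrier :=
  sumSingle k (fun i : FinPair f => i.base.Carrier) j

variable (f) in
/-- The relations of the colimit of all test coalgebras. -/
def kernelRelations : Submodule k (Π₀ i : FinPair f, i.base.Carrier) :=
  coequalizingCoideal (J := Σ i j : FinPair f, i.Hom j) (E := fun s => s.1.base.Carrier)
    (fun s => s.1.single) (fun s => s.2.1.single.comp s.2.2.hom)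

instance : (kernelRelations f).IsCoideal := by
  unfold kernelRelations
  infer_instance

variable (f) in
/-- The kernel pair of `f` in the category of coalgebras, as a colimit of finite-dimensional
coalgebras. -/
abbrev KernelPair : Type u := (Π₀ i : FinPair f, i.base.Carrier) ⧸ kernelRelations f

instance : Coalgebra k (KernelPair f) := inferInstance

/-- The structure morphism of the colimit. -/
def germ (j : FinPair f) : j.base.Carrier →ₗc[k] KernelPair f :=
  (Coalgebra.Quotient.mkQCoalgHom (kernelRelations f)).comp j.single

theorem germ_hom {i j : FinPair f} (s : i.Hom j) (x : i.base.Carrier) :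
    germ j (s.hom x) = germ i x :=
  (mkQ_coequalizingCoideal (J := Σ i j : FinPair f, i.Hom j) (E := fun s => s.1.base.Carrier)
    (fun s => s.1.single) (fun s => s.2.1.single.comp s.2.2.hom) ⟨i, j, s⟩ x).symm

theorem kernelPair_hom_ext {W : Type*} [AddCommGroup W] [Module k W] {φ ψ : KernelPair f →ₗ[k] W}
    (h : ∀ (j : FinPair f) (x : j.base.Carrier), φ (germ j x) = ψ (germ j x)) : φ = ψ := by
  classical
  apply Submodule.linearMap_qext
  ext j x
  exact h j x

/-- The morphism out of the kernel pair given by compatible morphisms out of the test coalgebras. -/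
def kernelDesc (g : ∀ j : FinPair f, j.base.Carrier →ₗc[k] C)
    (hg : ∀ (i j : FinPair f) (s : i.Hom j), (g j).comp s.hom = g i) : KernelPair f →ₗc[k] C :=
  quotientLift (sumDesc g) (coequalizingCoideal_le_ker fun s x => by
    exact (sumDesc_sumSingle g s.1 x).trans ((CoalgHom.congr_fun (hg _ _ s.2.2) x).symm.trans
      (sumDesc_sumSingle g s.2.1 (s.2.2.hom x)).symm))

theorem kernelDesc_germ (g : ∀ j : FinPair f, j.base.Carrier →ₗc[k] C)
    (hg : ∀ (i j : FinPair f) (s : i.Hom j), (g j).comp s.hom = g i) (j : FinPair f)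
    (x : j.base.Carrier) : kernelDesc g hg (germ j x) = g j x :=
  sumDesc_sumSingle g j x

variable (f) in
/-- The first projection of the kernel pair. -/
def kernelFst : KernelPair f →ₗc[k] C :=
  kernelDesc FinPair.fst fun _ _ s => s.fst_comp

variable (f) in
/-- The second projection of the kernel pair. -/
def kernelSnd : KernelPair f →ₗc[k] C :=
  kernelDesc FinPair.snd fun _ _ s => s.snd_comp

theorem kernelFst_germ (j : FinPair f) (x : j.base.Carrier) : kernelFst f (germ j x) = j.fst x :=
  kernelDesc_germ _ _ j x

theorem kernelSnd_germ (j : FinPair f) (x : j.base.Carrier) : kernelSnd f (germ j x) = j.snd x :=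
  kernelDesc_germ _ _ j x

theorem comp_kernelFst : f.comp (kernelFst f) = f.comp (kernelSnd f) := by
  have : (f.comp (kernelFst f)).toLinearMap = (f.comp (kernelSnd f)).toLinearMap := by
    apply kernelPair_hom_ext
    intro j x
    change f (kernelFst f (germ j x)) = f (kernelSnd f (germ j x))
    rw [kernelFst_germ, kernelSnd_germ]
    exact CoalgHom.congr_fun j.w x
  exact CoalgHom.ext fun x => LinearMap.congr_fun this x

theorem exists_finite_subcoalgebra_of_submodule {Q : Type*} [AddCommGroup Q] [Module k Q]
    [Coalgebra k Q] (S : Submodule k Q) [Module.Finite k S] :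
    ∃ (F : FinCoalg k) (h : F.Carrier →ₗc[k] Q),
      Function.Injective h ∧ (S : Set Q) ⊆ Set.range h := by
  obtain ⟨t, ht⟩ : ∃ t : Finset Q, Submodule.span k t = S :=
    (Submodule.fg_iff_finiteDimensional S).2 inferInstance
  obtain ⟨F, h, hi, hr⟩ := exists_finite_subcoalgebra (k := k) (t : Set Q) t.finite_toSet
  refine ⟨F, h, hi, ?_⟩
  have : S ≤ LinearMap.range h.toLinearMap := by
    rw [← ht, Submodule.span_le]
    exact hr
  exact this

section Lift

variable {Q : Type*} [AddCommGroup Q] [Module k Q] [Coalgebra k Q]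
  (a b : Q →ₗc[k] C) (hab : f.comp a = f.comp b)

/-- The test pair given by a finite-dimensional coalgebra over `Q`. -/
abbrev FinPair.ofHom {F : FinCoalg k} (h : F.Carrier →ₗc[k] Q) : FinPair f where
  base := F
  fst := a.comp h
  snd := b.comp h
  w := by rw [← CoalgHom.comp_assoc, hab, CoalgHom.comp_assoc]

/-- Both images lie in a common finite-dimensional subcoalgebra of Q, through which g and h factor;
there x and y become the same element, and germs are compatible with morphisms of test pairs. This
makes the lift below well defined. -/
theorem germ_ofHom_eq {G F : FinCoalg k}
    (g : G.Carrier →ₗc[k] Q) (h : F.Carrier →ₗc[k] Q) (x : G.Carrier) (y : F.Carrier)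
    (hxy : g x = h y) :
    germ (FinPair.ofHom a b hab g) x = germ (FinPair.ofHom a b hab h) y := by
  obtain ⟨L, r, hr, hsub⟩ := exists_finite_subcoalgebra_of_submodule
    (LinearMap.range g.toLinearMap ⊔ LinearMap.range h.toLinearMap)
  obtain ⟨s, hs⟩ := exists_factor_of_range_subset g r hr
    ((SetLike.coe_subset_coe.2 (le_sup_left (a := LinearMap.range g.toLinearMap))).trans hsub)
  obtain ⟨t, ht⟩ := exists_factor_of_range_subset h r hr
    ((SetLike.coe_subset_coe.2 (le_sup_right (b := LinearMap.range h.toLinearMap))).trans hsub)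
  let s' : (FinPair.ofHom a b hab g).Hom (FinPair.ofHom a b hab r) :=
    ⟨s, congrArg a.comp hs, congrArg b.comp hs⟩
  let t' : (FinPair.ofHom a b hab h).Hom (FinPair.ofHom a b hab r) :=
    ⟨t, congrArg a.comp ht, congrArg b.comp ht⟩
  rw [← germ_hom s', ← germ_hom t']
  congr 1
  apply hr
  change r.comp s x = r.comp t y
  rw [hs, ht, hxy]

/-- The value at x is the germ of x in any finite-dimensional coalgebra over Q that hits x.
Linearity and compatibility with Δ and ε involve finitely many elements at a time, so they can be
checked on one such coalgebra. -/
theorem exists_kernelLift : ∃ φ : Q →ₗc[k] KernelPair f,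
    ∀ (F : FinCoalg k) (h : F.Carrier →ₗc[k] Q) (x : F.Carrier),
      φ (h x) = germ (FinPair.ofHom a b hab h) x := by
  have hex : ∀ x : Q, ∃ p : KernelPair f, ∀ (F : FinCoalg k)
      (h : F.Carrier →ₗc[k] Q) (y : F.Carrier), h y = x →
        germ (FinPair.ofHom a b hab h) y = p := by
    intro x
    obtain ⟨F, h, -, hx⟩ := exists_finite_subcoalgebra (k := k) {x} (Set.finite_singleton x)
    obtain ⟨y, hy⟩ := hx rfl
    exact ⟨_, fun G g z hz => germ_ofHom_eq a b hab g h z y (hz.trans hy.symm)⟩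
  choose φ hφ using hex
  have hadd : ∀ x y, φ (x + y) = φ x + φ y := by
    intro x y
    obtain ⟨F, h, -, hx⟩ :=
      exists_finite_subcoalgebra (k := k) {x, y} (Set.toFinite _)
    obtain ⟨x', hx'⟩ := hx (Set.mem_insert x _)
    obtain ⟨y', hy'⟩ := hx (Set.mem_insert_of_mem x rfl)
    rw [← hφ x F h x' hx', ← hφ y F h y' hy', ← hφ (x + y) F h (x' + y') (by simp [*])]
    exact map_add (germ (FinPair.ofHom a b hab h)) _ _
  have hsmul : ∀ (r : k) x, φ (r • x) = r • φ x := by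
    intro r x
    obtain ⟨F, h, -, hx⟩ := exists_finite_subcoalgebra (k := k) {x} (Set.finite_singleton x)
    obtain ⟨x', hx'⟩ := hx rfl
    rw [← hφ x F h x' hx', ← hφ (r • x) F h (r • x') (by simp [*])]
    exact map_smul (germ (FinPair.ofHom a b hab h)) _ _
  let φ' : Q →ₗ[k] KernelPair f := ⟨⟨φ, hadd⟩, hsmul⟩
  have hφ' : ∀ (F : FinCoalg k) (h : F.Carrier →ₗc[k] Q),
      φ' ∘ₗ h.toLinearMap = (germ (FinPair.ofHom a b hab h)).toLinearMap :=
    fun F h => LinearMap.ext fun x => (hφ (h x) F h x rfl).symm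
  refine ⟨⟨φ', ?_, ?_⟩, fun F h x => LinearMap.congr_fun (hφ' F h) x⟩
  all_goals
    ext x
    obtain ⟨F, h, -, hx⟩ := exists_finite_subcoalgebra (k := k) {x} (Set.finite_singleton x)
    obtain ⟨y, rfl⟩ := hx rfl
    have h1 := hφ' F h
  · change (Coalgebra.counit ∘ₗ (φ' ∘ₗ h.toLinearMap)) y = (Coalgebra.counit ∘ₗ h.toLinearMap) y
    rw [h1, CoalgHom.counit_comp, CoalgHom.counit_comp]
  · change (TensorProduct.map φ' φ' ∘ₗ (Coalgebra.comul ∘ₗ h.toLinearMap)) y =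
      (Coalgebra.comul ∘ₗ (φ' ∘ₗ h.toLinearMap)) y
    rw [← h.map_comp_comul, ← LinearMap.comp_assoc, ← TensorProduct.map_comp, h1,
      ← CoalgHom.map_comp_comul]

end Lift

/-- A morphism from a test coalgebra to the kernel pair over `C` is the structure morphism of the
colimit. -/
theorem eq_germ (j : FinPair f) (ψ : j.base.Carrier →ₗc[k] KernelPair f)
    (h1 : (kernelFst f).comp ψ = j.fst) (h2 : (kernelSnd f).comp ψ = j.snd) : ψ = germ j := by
  -- φ is the lift of the tautological pair on the kernel pair itself. It turns every morphism χ
  -- over the two projections into a germ; taking χ to be a germ shows φ = id, and then χ = ψ gives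
  -- the claim.
  obtain ⟨φ, hφ⟩ := exists_kernelLift (kernelFst f) (kernelSnd f) comp_kernelFst
  have key : ∀ (i : FinPair f) (χ : i.base.Carrier →ₗc[k] KernelPair f),
      (kernelFst f).comp χ = i.fst → (kernelSnd f).comp χ = i.snd →
        ∀ x, φ (χ x) = germ i x := by
    intro i χ g1 g2 x
    obtain ⟨F, h, hi, hsub⟩ := exists_finite_subcoalgebra_of_submodule
      (LinearMap.range χ.toLinearMap)
    obtain ⟨s, hs⟩ := exists_factor_of_range_subset χ h hi hsub
    let s' : i.Hom (FinPair.ofHom (kernelFst f) (kernelSnd f) comp_kernelFst h) :=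
      ⟨s, (congrArg (kernelFst f).comp hs).trans g1, (congrArg (kernelSnd f).comp hs).trans g2⟩
    rw [← germ_hom s', ← hs]
    exact hφ F h (s x)
  have hid : φ.toLinearMap = LinearMap.id := by
    apply kernelPair_hom_ext
    intro i x
    exact key i (germ i) (CoalgHom.ext fun y => kernelFst_germ i y)
      (CoalgHom.ext fun y => kernelSnd_germ i y) x
  ext x
  rw [← key j ψ h1 h2 x]
  exact (LinearMap.congr_fun hid (ψ x)).symm

/-- The universal property of the kernel pair. -/
theorem existsUnique_kernelLift {Q : Type*} [AddCommGroup Q] [Module k Q] [Coalgebra k Q]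
    (a b : Q →ₗc[k] C) (hab : f.comp a = f.comp b) :
    ∃! φ : Q →ₗc[k] KernelPair f, (kernelFst f).comp φ = a ∧ (kernelSnd f).comp φ = b := by
  obtain ⟨φ, hφ⟩ := exists_kernelLift a b hab
  refine ⟨φ, ⟨?_, ?_⟩, ?_⟩
  · ext x
    obtain ⟨F, h, -, hx⟩ := exists_finite_subcoalgebra (k := k) {x} (Set.finite_singleton x)
    obtain ⟨y, rfl⟩ := hx rfl
    rw [CoalgHom.comp_apply, hφ]
    exact kernelFst_germ (FinPair.ofHom a b hab h) y
  · ext x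
    obtain ⟨F, h, -, hx⟩ := exists_finite_subcoalgebra (k := k) {x} (Set.finite_singleton x)
    obtain ⟨y, rfl⟩ := hx rfl
    rw [CoalgHom.comp_apply, hφ]
    exact kernelSnd_germ (FinPair.ofHom a b hab h) y
  · rintro ψ ⟨rfl, rfl⟩
    ext x
    obtain ⟨F, h, -, hx⟩ := exists_finite_subcoalgebra (k := k) {x} (Set.finite_singleton x)
    obtain ⟨y, rfl⟩ := hx rfl
    rw [hφ]
    exact CoalgHom.congr_fun (eq_germ (FinPair.ofHom _ _ hab h) (ψ.comp h) rfl rfl) y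

/-- The kernel pair of a coalgebra morphism is a pullback in the category of coalgebras. -/
theorem isPullback_kernelPair (f : C →ₗc[k] D) :
    IsPullback (CoalgCat.ofHom (kernelFst f)) (CoalgCat.ofHom (kernelSnd f))
      (CoalgCat.ofHom f) (CoalgCat.ofHom f) := by
  have hu : ∀ s : Limits.PullbackCone (CoalgCat.ofHom f) (CoalgCat.ofHom f),
      ∃! φ : s.pt →ₗc[k] KernelPair f,
        (kernelFst f).comp φ = s.fst.toCoalgHom ∧ (kernelSnd f).comp φ = s.snd.toCoalgHom :=
    fun s => existsUnique_kernelLift _ _ (congrArg CoalgCat.Hom.toCoalgHom s.condition)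
  choose φ hφ hφu using hu
  refine ⟨⟨CoalgCat.hom_ext _ _ comp_kernelFst⟩, ⟨Limits.PullbackCone.IsLimit.mk _
    (fun s => ⟨φ s⟩) (fun s => CoalgCat.hom_ext _ _ (hφ s).1)
    (fun s => CoalgCat.hom_ext _ _ (hφ s).2) fun s m h1 h2 => CoalgCat.hom_ext _ _ ?_⟩⟩
  exact hφu s m.toCoalgHom
    ⟨congrArg CoalgCat.Hom.toCoalgHom h1, congrArg CoalgCat.Hom.toCoalgHom h2⟩

end KernelPair

/-! ### Coequalizers in the category of coalgebras. -/

section Coequalizers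

variable {k : Type u} [Field k]

/-- Parallel pairs of coalgebra morphisms have coequalizers. -/
theorem exists_coequalizer {X Y : CoalgCat.{u} k} (a b : X ⟶ Y) :
    ∃ (Z : CoalgCat.{u} k) (q : Y ⟶ Z) (w : a ≫ q = b ≫ q),
      Nonempty (Limits.IsColimit (Limits.Cofork.ofπ q w)) := by
  let I : Submodule k Y := coequalizingCoideal (J := Unit) (E := fun _ => X)
    (fun _ => a.toCoalgHom) (fun _ => b.toCoalgHom)
  have : I.IsCoideal := by unfold I; infer_instance
  have w : a ≫ CoalgCat.ofHom (Coalgebra.Quotient.mkQCoalgHom (R := k) I) =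
      b ≫ CoalgCat.ofHom (Coalgebra.Quotient.mkQCoalgHom (R := k) I) := by
    refine CoalgCat.hom_ext _ _ (CoalgHom.ext fun x => ?_)
    exact mkQ_coequalizingCoideal (J := Unit) (E := fun _ => X)
      (fun _ => a.toCoalgHom) (fun _ => b.toCoalgHom) () x
  refine ⟨CoalgCat.of k (Y ⧸ I), CoalgCat.ofHom (Coalgebra.Quotient.mkQCoalgHom (R := k) I), w,
    ⟨Limits.Cofork.IsColimit.mk _ (fun s => ⟨quotientLift s.π.toCoalgHom ?_⟩) ?_ ?_⟩⟩
  · refine coequalizingCoideal_le_ker fun _ x => ?_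
    exact CoalgHom.congr_fun (congrArg CoalgCat.Hom.toCoalgHom s.condition) x
  · intro s
    exact CoalgCat.hom_ext _ _ (CoalgHom.ext fun x => rfl)
  · intro s m hm
    refine CoalgCat.hom_ext _ _ (CoalgHom.ext fun x => ?_)
    obtain ⟨y, rfl⟩ := I.mkQ_surjective x
    exact CoalgHom.congr_fun (congrArg CoalgCat.Hom.toCoalgHom hm) y

end Coequalizers

/-! ### Codominions and kernel pairs in a general category. -/

section Domination

variable {𝒞 : Type*} [Category 𝒞]

/-- The coequalizer of a and b is a regular quotient through which f factors, so by minimality q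
factors through it. -/
theorem IsCodominion.equalizes
    (hc : ∀ {x y : 𝒞} (a b : x ⟶ y), ∃ (z : 𝒞) (q : y ⟶ z) (w : a ≫ q = b ≫ q),
      Nonempty (Limits.IsColimit (Limits.Cofork.ofπ q w)))
    {c d c' : 𝒞} {f : c ⟶ d} {q : c ⟶ c'} (hq : IsCodominion f q) {x : 𝒞} (a b : x ⟶ c)
    (hab : a ≫ f = b ≫ f) : a ≫ q = b ≫ q := by
  obtain ⟨z, r, w, ⟨hr⟩⟩ := hc a b
  obtain ⟨t, rfl⟩ := hq.smallest z r ⟨⟨⟨x, a, b, w, hr⟩⟩⟩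
    ⟨Limits.Cofork.IsColimit.desc hr f hab, Limits.Cofork.IsColimit.π_desc' hr f hab⟩
  rw [reassoc_of% w]

/-- The codominion of `f` is the coequalizer of its kernel pair. -/
theorem isCodominion_of_isPullback {c d c' p : 𝒞} {f : c ⟶ d} {q : c ⟶ c'} {p₁ p₂ : p ⟶ c}
    (hp : IsPullback p₁ p₂ f f) (w : p₁ ≫ q = p₂ ≫ q)
    (hq : Limits.IsColimit (Limits.Cofork.ofπ q w)) : IsCodominion f q where
  regular := ⟨⟨⟨p, p₁, p₂, w, hq⟩⟩⟩
  factors := ⟨Limits.Cofork.IsColimit.desc hq f hp.w, Limits.Cofork.IsColimit.π_desc' hq f hp.w⟩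
  smallest := by
    rintro e r ⟨⟨x, a, b, w', hr⟩⟩ ⟨g, rfl⟩
    have hab : a ≫ r ≫ g = b ≫ r ≫ g := by rw [reassoc_of% w']
    -- Since f factors through r, the pair a, b with coequalizer r factors through the kernel pair
    -- of f, and q identifies the projections.
    have h : a ≫ q = b ≫ q := by
      rw [← hp.lift_fst a b hab, Category.assoc, w, ← Category.assoc, hp.lift_snd]
    exact ⟨Limits.Cofork.IsColimit.desc hr q h, Limits.Cofork.IsColimit.π_desc' hr q h⟩

end Domination

/-! ### Conditions (a), (b), (c), and the variant with f factoring through π. -/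

section Equivalences

variable {k : Type u} [Field k]
variable {C : Type u} [AddCommGroup C] [Module k C] [Coalgebra k C]
variable {D : Type u} [AddCommGroup D] [Module k D] [Coalgebra k D]
variable {D' : Type u} [AddCommGroup D'] [Module k D'] [Coalgebra k D']
variable {f : C →ₗc[k] D} {π : C →ₗc[k] D'}

theorem EqualizesPairs.of_dominates (h : Dominates (CoalgCat.ofHom f) (CoalgCat.ofHom π)) :
    EqualizesPairs f π := by
  obtain ⟨c', q, hq, p, hp⟩ := h
  intro C' _ _ _ f₁ f₂ h
  have h1 := hq.equalizes exists_coequalizer (CoalgCat.ofHom f₁) (CoalgCat.ofHom f₂)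
    (CoalgCat.hom_ext _ _ h)
  have h2 : CoalgCat.ofHom f₁ ≫ CoalgCat.ofHom π = CoalgCat.ofHom f₂ ≫ CoalgCat.ofHom π := by
    rw [← hp, reassoc_of% h1]
  exact congrArg CoalgCat.Hom.toCoalgHom h2

theorem EqualizesPairs.coequalizesPullback (h : EqualizesPairs f π) : CoequalizesPullback f π :=
  ⟨_, _, _, isPullback_kernelPair f, CoalgCat.hom_ext _ _ (h _ _ _ comp_kernelFst)⟩

theorem CoequalizesPullback.dominates (h : CoequalizesPullback f π) :
    Dominates (CoalgCat.ofHom f) (CoalgCat.ofHom π) := by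
  obtain ⟨P, p₁, p₂, hP, hπ⟩ := h
  obtain ⟨Z, q, w, ⟨hq⟩⟩ := exists_coequalizer p₁ p₂
  exact ⟨Z, q, isCodominion_of_isPullback hP w hq, Limits.Cofork.IsColimit.desc hq _ hπ,
    Limits.Cofork.IsColimit.π_desc' hq _ hπ⟩

/-- The map D' → D asked for can be the given g, because q ≫ p ≫ g is then π followed by g. -/
theorem dominatesBetween_iff_dominates (hg : ∃ g : D' →ₗc[k] D, g.comp π = f) :
    DominatesBetween (CoalgCat.ofHom f) (CoalgCat.ofHom π) ↔
      Dominates (CoalgCat.ofHom f) (CoalgCat.ofHom π) := by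
  constructor
  · rintro ⟨c', q, p, g, hq, hp, -⟩
    exact ⟨c', q, hq, p, hp⟩
  · rintro ⟨c', q, hq, p, hp⟩
    obtain ⟨g, hg⟩ := hg
    refine ⟨c', q, p, CoalgCat.ofHom g, hq, hp, ?_⟩
    rw [← Category.assoc, hp]
    exact CoalgCat.hom_ext _ _ hg

end Equivalences

/-! ### The cotensor square and its bicomodule structure. -/

section Cotensor

variable {k : Type*} [Field k]
variable {C : Type*} [AddCommGroup C] [Module k C] [Coalgebra k C]
variable {D : Type*} [AddCommGroup D] [Module k D] [Coalgebra k D]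
variable {W : Type*} [AddCommGroup W] [Module k W]

theorem rTensor_lTensor_apply {V D₀ C₀ : Type*} [AddCommGroup V] [Module k V] [AddCommGroup C₀]
    [Module k C₀] [AddCommGroup D₀] [Module k D₀] (g : V →ₗ[k] W) (h : C₀ →ₗ[k] D₀)
    (t : V ⊗[k] C₀) : g.rTensor D₀ (h.lTensor V t) = h.lTensor W (g.rTensor C₀ t) := by
  rw [← LinearMap.comp_apply, ← LinearMap.comp_apply, LinearMap.rTensor_comp_lTensor,
    LinearMap.lTensor_comp_rTensor]

/-- The map `a ⊗ b ↦ a₁ ⊗ f a₂ ⊗ b`. -/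
def cotensorLeft (f : C →ₗc[k] D) : C ⊗[k] C →ₗ[k] C ⊗[k] (D ⊗[k] C) :=
  (TensorProduct.assoc k C D C).toLinearMap ∘ₗ
    (f.toLinearMap.lTensor C ∘ₗ Coalgebra.comul).rTensor C

/-- The map `a ⊗ b ↦ a ⊗ f b₁ ⊗ b₂`. -/
def cotensorRight (f : C →ₗc[k] D) : C ⊗[k] C →ₗ[k] C ⊗[k] (D ⊗[k] C) :=
  (f.toLinearMap.rTensor C ∘ₗ Coalgebra.comul).lTensor C

theorem mem_selfCotensor {f : C →ₗc[k] D} {y : C ⊗[k] C} :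
    y ∈ selfCotensor f ↔ cotensorLeft f y = cotensorRight f y :=
  Iff.rfl

/-- By coassociativity the two defining expressions are f₁(x₁) ⊗ f f₁(x₂) ⊗ f₂(x₃) and f₁(x₁) ⊗ f
f₂(x₂) ⊗ f₂(x₃). -/
theorem map_comul_mem_selfCotensor {C' : Type*} [AddCommGroup C'] [Module k C'] [Coalgebra k C']
    {f : C →ₗc[k] D} {f₁ f₂ : C' →ₗc[k] C} (h : f.comp f₁ = f.comp f₂) (x : C') :
    TensorProduct.map f₁.toLinearMap f₂.toLinearMap (Coalgebra.comul x) ∈ selfCotensor f := by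
  have hf : f.toLinearMap ∘ₗ f₁.toLinearMap = f.toLinearMap ∘ₗ f₂.toLinearMap :=
    LinearMap.ext fun x => CoalgHom.congr_fun h x
  have h1 : cotensorLeft f ∘ₗ TensorProduct.map f₁.toLinearMap f₂.toLinearMap =
      TensorProduct.map f₁.toLinearMap
          (TensorProduct.map (f.toLinearMap ∘ₗ f₁.toLinearMap) f₂.toLinearMap) ∘ₗ
        (TensorProduct.assoc k C' C' C').toLinearMap ∘ₗ
          (Coalgebra.comul (R := k) (A := C')).rTensor C' := by
    rw [cotensorLeft, LinearMap.comp_assoc, LinearMap.rTensor_comp_map, LinearMap.comp_assoc,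
      ← f₁.map_comp_comul]
    ext a b
    simp only [TensorProduct.AlgebraTensorModule.curry_apply, LinearMap.restrictScalars_self,
      TensorProduct.curry_apply, LinearMap.comp_apply, LinearMap.rTensor_tmul,
      TensorProduct.map_tmul, LinearEquiv.coe_coe]
    generalize Coalgebra.comul (R := k) a = t
    induction t with
    | zero => simp
    | tmul x y => simp
    | add x y hx hy => simp only [map_add, TensorProduct.add_tmul, hx, hy]
  have h2 : cotensorRight f ∘ₗ TensorProduct.map f₁.toLinearMap f₂.toLinearMap =
      TensorProduct.map f₁.toLinearMap
          (TensorProduct.map (f.toLinearMap ∘ₗ f₂.toLinearMap) f₂.toLinearMap) ∘ₗ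
        (Coalgebra.comul (R := k) (A := C')).lTensor C' := by
    rw [cotensorRight, LinearMap.lTensor_comp_map, LinearMap.map_comp_lTensor,
      LinearMap.comp_assoc, ← f₂.map_comp_comul, ← LinearMap.comp_assoc,
      LinearMap.rTensor_comp_map]
  have a1 := LinearMap.congr_fun h1 (Coalgebra.comul x)
  have a2 := LinearMap.congr_fun h2 (Coalgebra.comul x)
  simp only [LinearMap.comp_apply, LinearEquiv.coe_coe] at a1 a2
  rw [mem_selfCotensor, a1, a2, Coalgebra.coassoc_apply, hf]

theorem idTensorCounit_map_comul {C' : Type*} [AddCommGroup C'] [Module k C'] [Coalgebra k C']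
    (f₁ f₂ : C' →ₗc[k] C) (x : C') :
    idTensorCounit k C (TensorProduct.map f₁.toLinearMap f₂.toLinearMap (Coalgebra.comul x)) =
      f₁ x := by
  have h : idTensorCounit k C ∘ₗ TensorProduct.map f₁.toLinearMap f₂.toLinearMap =
      f₁.toLinearMap ∘ₗ (TensorProduct.rid k C').toLinearMap ∘ₗ
        (Coalgebra.counit (R := k) (A := C')).lTensor C' := by
    ext; simp [idTensorCounit]
  have a := LinearMap.congr_fun h (Coalgebra.comul x)
  simp only [LinearMap.comp_apply, Coalgebra.lTensor_counit_comul] at a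
  rw [a]
  simp

theorem counitTensorId_map_comul {C' : Type*} [AddCommGroup C'] [Module k C'] [Coalgebra k C']
    (f₁ f₂ : C' →ₗc[k] C) (x : C') :
    counitTensorId k C (TensorProduct.map f₁.toLinearMap f₂.toLinearMap (Coalgebra.comul x)) =
      f₂ x := by
  have h : counitTensorId k C ∘ₗ TensorProduct.map f₁.toLinearMap f₂.toLinearMap =
      f₂.toLinearMap ∘ₗ (TensorProduct.lid k C').toLinearMap ∘ₗ
        (Coalgebra.counit (R := k) (A := C')).rTensor C' := by
    ext; simp [counitTensorId]
  have a := LinearMap.congr_fun h (Coalgebra.comul x)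
  simp only [LinearMap.comp_apply, Coalgebra.rTensor_counit_comul] at a
  rw [a]
  simp

/-- For s = w ⊗ c both sides are w₀ ⊗ w₁ ⊗ f(w₂) ⊗ c, by coassociativity of N. With the next lemma
this carries a cotensor identity for s over to the middle legs of w₀ ⊗ w₁ ⊗ c. -/
theorem lTensor_cotensorLeft_coact (f : C →ₗc[k] D) (N : RightComodule k C W) (s : W ⊗[k] C) :
    (cotensorLeft f).lTensor W (TensorProduct.assoc k W C C (N.coact.rTensor C s)) =
      TensorProduct.assoc k W C (D ⊗[k] C) (N.coact.rTensor (D ⊗[k] C)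
        (TensorProduct.assoc k W D C ((f.toLinearMap.lTensor W ∘ₗ N.coact).rTensor C s))) := by
  induction s with
  | zero => simp
  | add x y hx hy => simp only [map_add, hx, hy]
  | tmul w c =>
    let A : W ⊗[k] (C ⊗[k] C) →ₗ[k] W ⊗[k] (C ⊗[k] (D ⊗[k] C)) :=
      (((TensorProduct.mk k D C).flip c ∘ₗ f.toLinearMap).lTensor C).lTensor W
    have h1 : ∀ t : W ⊗[k] C, (cotensorLeft f).lTensor W (TensorProduct.assoc k W C C (t ⊗ₜ c)) =
        A ((Coalgebra.comul (R := k) (A := C)).lTensor W t) := by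
      intro t
      induction t with
      | zero => simp
      | add x y hx hy => simp only [map_add, TensorProduct.add_tmul, hx, hy]
      | tmul w x =>
        simp only [A, cotensorLeft, TensorProduct.assoc_tmul, LinearMap.lTensor_tmul,
          LinearMap.comp_apply, LinearMap.rTensor_tmul, LinearEquiv.coe_coe]
        generalize Coalgebra.comul (R := k) x = t
        induction t with
        | zero => simp
        | tmul x y => simp
        | add x y hx hy =>
          simp only [map_add, TensorProduct.add_tmul, TensorProduct.tmul_add, hx, hy]
    have h2 : ∀ t : W ⊗[k] C, TensorProduct.assoc k W C (D ⊗[k] C) (N.coact.rTensor (D ⊗[k] C)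
        (TensorProduct.assoc k W D C (f.toLinearMap.lTensor W t ⊗ₜ c))) =
        A (TensorProduct.assoc k W C C (N.coact.rTensor C t)) := by
      intro t
      induction t with
      | zero => simp
      | add x y hx hy => simp only [map_add, TensorProduct.add_tmul, hx, hy]
      | tmul w x =>
        simp only [A, TensorProduct.assoc_tmul, LinearMap.lTensor_tmul, LinearMap.rTensor_tmul]
        generalize N.coact w = t
        induction t with
        | zero => simp
        | tmul x y => simp
        | add x y hx hy => simp only [map_add, TensorProduct.add_tmul, hx, hy]
    have h3 := LinearMap.congr_fun N.coassoc w
    simp only [LinearMap.comp_apply, LinearEquiv.coe_coe] at h3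
    simp only [LinearMap.rTensor_tmul, LinearMap.comp_apply]
    rw [h1, h2, h3]

/-- For s = w ⊗ c both sides are w₀ ⊗ w₁ ⊗ f(c₁) ⊗ c₂; here the coaction and the comultiplication
act on different factors. -/
theorem lTensor_cotensorRight_coact (f : C →ₗc[k] D) (N : RightComodule k C W) (s : W ⊗[k] C) :
    (cotensorRight f).lTensor W (TensorProduct.assoc k W C C (N.coact.rTensor C s)) =
      TensorProduct.assoc k W C (D ⊗[k] C) (N.coact.rTensor (D ⊗[k] C)
        ((f.toLinearMap.rTensor C ∘ₗ Coalgebra.comul).lTensor W s)) := by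
  induction s with
  | zero => simp
  | add x y hx hy => simp only [map_add, hx, hy]
  | tmul w c =>
    simp only [LinearMap.rTensor_tmul, LinearMap.lTensor_tmul]
    generalize N.coact w = t
    induction t with
    | zero => simp
    | tmul x y => simp [cotensorRight]
    | add x y hx hy => simp only [map_add, TensorProduct.add_tmul, hx, hy]

theorem lTensor_idTensorCounit_coact (N : RightComodule k C W) (s : W ⊗[k] C) :
    (idTensorCounit k C).lTensor W (TensorProduct.assoc k W C C (N.coact.rTensor C s)) =
      N.coact (rightSlice Coalgebra.counit s) := by
  induction s with
  | zero => simp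
  | add x y hx hy => simp only [map_add, hx, hy]
  | tmul w c =>
    simp only [LinearMap.rTensor_tmul, rightSlice_tmul, map_smul]
    generalize N.coact w = t
    induction t with
    | zero => simp
    | tmul x y => simp [idTensorCounit]
    | add x y hx hy => simp only [map_add, TensorProduct.add_tmul, hx, hy, smul_add]

theorem lTensor_counitTensorId_coact (N : RightComodule k C W) (s : W ⊗[k] C) :
    (counitTensorId k C).lTensor W (TensorProduct.assoc k W C C (N.coact.rTensor C s)) = s := by
  induction s with
  | zero => simp
  | add x y hx hy => simp only [map_add, hx, hy]
  | tmul w c =>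
    have h : ∀ t : W ⊗[k] C, (counitTensorId k C).lTensor W
        (TensorProduct.assoc k W C C (t ⊗ₜ c)) = rightSlice Coalgebra.counit t ⊗ₜ c := by
      intro t
      induction t with
      | zero => simp
      | tmul x y => simp [counitTensorId, TensorProduct.smul_tmul]
      | add x y hx hy => simp only [map_add, TensorProduct.add_tmul, hx, hy]
    rw [LinearMap.rTensor_tmul, h, N.rightSlice_counit]

/-- Elements `a ⊗ b` of the cotensor square satisfy `a₁ ⊗ f a₂ ε(b) = a ⊗ f b`. -/
theorem lTensor_comul_idTensorCounit {f : C →ₗc[k] D} {y : C ⊗[k] C} (hy : y ∈ selfCotensor f) :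
    f.toLinearMap.lTensor C (Coalgebra.comul (idTensorCounit k C y)) =
      f.toLinearMap.lTensor C y := by
  -- The claim is the defining equation of the cotensor product with ε applied to its last leg.
  have h1 : (rightSlice Coalgebra.counit).lTensor C ∘ₗ cotensorLeft f =
      f.toLinearMap.lTensor C ∘ₗ Coalgebra.comul ∘ₗ idTensorCounit k C := by
    ext a b
    simp only [TensorProduct.AlgebraTensorModule.curry_apply, LinearMap.restrictScalars_self,
      TensorProduct.curry_apply, LinearMap.comp_apply, LinearMap.rTensor_tmul, cotensorLeft,
      LinearEquiv.coe_coe, idTensorCounit, LinearMap.lTensor_tmul, TensorProduct.rid_tmul, map_smul]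
    generalize Coalgebra.comul (R := k) a = t
    induction t with
    | zero => simp
    | tmul x y => simp
    | add x y hx hy => simp only [map_add, TensorProduct.add_tmul, hx, hy, smul_add]
  have h2 : (rightSlice Coalgebra.counit).lTensor C ∘ₗ cotensorRight f =
      f.toLinearMap.lTensor C := by
    rw [cotensorRight, ← LinearMap.lTensor_comp]
    congr 1
    ext c
    simp only [LinearMap.comp_apply, rightSlice_rTensor]
    rw [show rightSlice Coalgebra.counit (Coalgebra.comul (R := k) c) = c from
      (RightComodule.regular k C).rightSlice_counit c]
  have a1 := LinearMap.congr_fun h1 y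
  have a2 := LinearMap.congr_fun h2 y
  simp only [LinearMap.comp_apply] at a1 a2
  rw [← a1, ← a2, mem_selfCotensor.1 hy]

theorem leftSlice_counit_eq (y : C ⊗[k] C) :
    leftSlice Coalgebra.counit y = counitTensorId k C y := rfl

/-- Apply ε to the first leg of the hypothesis. This will be used both for f and for π. -/
theorem map_idTensorCounit_eq {f : C →ₗc[k] D} {y : C ⊗[k] C} (hy : f.toLinearMap.lTensor C
      (Coalgebra.comul (idTensorCounit k C y)) = f.toLinearMap.lTensor C y) :
    f (idTensorCounit k C y) = f (counitTensorId k C y) := by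
  have h := congrArg (leftSlice Coalgebra.counit) hy
  rw [leftSlice_lTensor, leftSlice_lTensor, leftSlice_counit_eq y] at h
  rw [show leftSlice Coalgebra.counit (Coalgebra.comul (R := k) (idTensorCounit k C y)) =
    idTensorCounit k C y from (LeftComodule.regular k C).leftSlice_counit _] at h
  exact h

/-- `C ⊗ C` as a bicomodule through the outer factors. -/
def Bicomodule.outer (k C : Type*) [Field k] [AddCommGroup C] [Module k C] [Coalgebra k C] :
    Bicomodule k C (C ⊗[k] C) where
  left :=
    { coact := (TensorProduct.assoc k C C C).toLinearMap ∘ₗ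
        (Coalgebra.comul (R := k) (A := C)).rTensor C
      coassoc := by
        ext a b
        have h := congrArg (fun t => TensorProduct.assoc k C C (C ⊗[k] C)
          (TensorProduct.assoc k (C ⊗[k] C) C C (t ⊗ₜ b)))
          (Coalgebra.coassoc_symm_apply (R := k) a)
        have h1 : ∀ t : C ⊗[k] C, (TensorProduct.assoc k C C (C ⊗[k] C))
            ((Coalgebra.comul (R := k) (A := C)).rTensor (C ⊗[k] C)
              (TensorProduct.assoc k C C C (t ⊗ₜ b))) =
            TensorProduct.assoc k C C (C ⊗[k] C) (TensorProduct.assoc k (C ⊗[k] C) C C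
              ((Coalgebra.comul (R := k) (A := C)).rTensor C t ⊗ₜ b)) := by
          intro t
          induction t with
          | zero => simp
          | tmul x y => simp
          | add x y hx hy => simp only [map_add, TensorProduct.add_tmul, hx, hy]
        have h2 : ∀ t : C ⊗[k] C, ((TensorProduct.assoc k C C C).toLinearMap ∘ₗ
            (Coalgebra.comul (R := k) (A := C)).rTensor C).lTensor C
              (TensorProduct.assoc k C C C (t ⊗ₜ b)) =
            TensorProduct.assoc k C C (C ⊗[k] C) (TensorProduct.assoc k (C ⊗[k] C) C C
              ((TensorProduct.assoc k C C C).symm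
                ((Coalgebra.comul (R := k) (A := C)).lTensor C t) ⊗ₜ b)) := by
          intro t
          induction t with
          | zero => simp
          | tmul x y =>
            simp only [LinearMap.lTensor_tmul, TensorProduct.assoc_tmul, LinearMap.comp_apply,
              LinearMap.rTensor_tmul, LinearEquiv.coe_coe]
            generalize Coalgebra.comul (R := k) y = t
            induction t with
            | zero => simp
            | tmul x y => simp
            | add x y hx hy =>
              simp only [map_add, TensorProduct.add_tmul, TensorProduct.tmul_add, hx, hy]
          | add x y hx hy => simp only [map_add, TensorProduct.add_tmul, hx, hy]
        simp only [TensorProduct.AlgebraTensorModule.curry_apply, LinearMap.restrictScalars_self,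
          TensorProduct.curry_apply, LinearMap.comp_apply, LinearMap.rTensor_tmul,
          LinearEquiv.coe_coe] at h ⊢
        rw [h1, h2, h]
      counit := by
        ext a b
        have h1 : ∀ t : C ⊗[k] C, (Coalgebra.counit (R := k) (A := C)).rTensor (C ⊗[k] C)
            (TensorProduct.assoc k C C C (t ⊗ₜ b)) = TensorProduct.assoc k k C C
              ((Coalgebra.counit (R := k) (A := C)).rTensor C t ⊗ₜ b) := by
          intro t
          induction t with
          | zero => simp
          | tmul x y => simp
          | add x y hx hy => simp only [map_add, TensorProduct.add_tmul, hx, hy]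
        simp [h1] }
  right :=
    { coact := (TensorProduct.assoc k C C C).symm.toLinearMap ∘ₗ
        (Coalgebra.comul (R := k) (A := C)).lTensor C
      coassoc := by
        ext a b
        have h := congrArg (fun t => (TensorProduct.assoc k C C (C ⊗[k] C)).symm (a ⊗ₜ t))
          (Coalgebra.coassoc_apply (R := k) b)
        have h1 : ∀ t : C ⊗[k] C, (TensorProduct.assoc k (C ⊗[k] C) C C)
            (((TensorProduct.assoc k C C C).symm.toLinearMap ∘ₗ
              (Coalgebra.comul (R := k) (A := C)).lTensor C).rTensor C
                ((TensorProduct.assoc k C C C).symm (a ⊗ₜ t))) =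
            (TensorProduct.assoc k C C (C ⊗[k] C)).symm (a ⊗ₜ TensorProduct.assoc k C C C
              ((Coalgebra.comul (R := k) (A := C)).rTensor C t)) := by
          intro t
          induction t with
          | zero => simp
          | tmul x y =>
            simp only [LinearMap.lTensor_tmul, TensorProduct.assoc_symm_tmul, LinearMap.comp_apply,
              LinearMap.rTensor_tmul, LinearEquiv.coe_coe]
            generalize Coalgebra.comul (R := k) x = t
            induction t with
            | zero => simp
            | tmul x y => simp
            | add x y hx hy =>
              simp only [map_add, TensorProduct.add_tmul, TensorProduct.tmul_add, hx, hy]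
          | add x y hx hy => simp only [map_add, TensorProduct.tmul_add, hx, hy]
        have h2 : ∀ t : C ⊗[k] C, (Coalgebra.comul (R := k) (A := C)).lTensor (C ⊗[k] C)
              ((TensorProduct.assoc k C C C).symm (a ⊗ₜ t)) =
            (TensorProduct.assoc k C C (C ⊗[k] C)).symm (a ⊗ₜ
              ((Coalgebra.comul (R := k) (A := C)).lTensor C t)) := by
          intro t
          induction t with
          | zero => simp
          | tmul x y => simp
          | add x y hx hy => simp only [map_add, TensorProduct.tmul_add, hx, hy]
        simp only [TensorProduct.AlgebraTensorModule.curry_apply, LinearMap.restrictScalars_self,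
          TensorProduct.curry_apply, LinearMap.comp_apply, LinearMap.lTensor_tmul,
          LinearEquiv.coe_coe] at h ⊢
        rw [h2, ← h, ← h1]
      counit := by
        ext a b
        have h1 : ∀ t : C ⊗[k] C, (Coalgebra.counit (R := k) (A := C)).lTensor (C ⊗[k] C)
            ((TensorProduct.assoc k C C C).symm (a ⊗ₜ t)) = (TensorProduct.assoc k C C k).symm
              (a ⊗ₜ (Coalgebra.counit (R := k) (A := C)).lTensor C t) := by
          intro t
          induction t with
          | zero => simp
          | tmul x y => simp
          | add x y hx hy => simp only [map_add, TensorProduct.tmul_add, hx, hy]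
        simp [h1] }
  comm := by
    ext a b
    let Θ : (C ⊗[k] C) ⊗[k] (C ⊗[k] C) →ₗ[k] C ⊗[k] ((C ⊗[k] C) ⊗[k] C) :=
      (TensorProduct.assoc k C (C ⊗[k] C) C).toLinearMap ∘ₗ
        (TensorProduct.assoc k C C C).toLinearMap.rTensor C ∘ₗ
          (TensorProduct.assoc k (C ⊗[k] C) C C).symm.toLinearMap
    have hL : ∀ s : C ⊗[k] C, TensorProduct.assoc k C (C ⊗[k] C) C
        (((TensorProduct.assoc k C C C).toLinearMap ∘ₗ
          (Coalgebra.comul (R := k) (A := C)).rTensor C).rTensor C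
            ((TensorProduct.assoc k C C C).symm (a ⊗ₜ s))) = Θ (Coalgebra.comul a ⊗ₜ s) := by
      intro s
      induction s with
      | zero => simp
      | tmul x y => simp [Θ]
      | add x y hx hy => simp only [map_add, TensorProduct.tmul_add, hx, hy]
    have hR : ∀ t : C ⊗[k] C, ((TensorProduct.assoc k C C C).symm.toLinearMap ∘ₗ
        (Coalgebra.comul (R := k) (A := C)).lTensor C).lTensor C
          (TensorProduct.assoc k C C C (t ⊗ₜ b)) = Θ (t ⊗ₜ Coalgebra.comul b) := by
      intro t
      induction t with
      | zero => simp
      | tmul x y =>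
        simp only [TensorProduct.assoc_tmul, LinearMap.lTensor_tmul, LinearMap.comp_apply]
        generalize Coalgebra.comul (R := k) b = s
        induction s with
        | zero => simp
        | tmul y z => simp [Θ]
        | add x y hx hy => simp only [map_add, TensorProduct.tmul_add, hx, hy]
      | add x y hx hy => simp only [map_add, TensorProduct.add_tmul, hx, hy]
    exact (hL (Coalgebra.comul b)).trans (hR (Coalgebra.comul a)).symm

theorem rightSlice_outer (α : C →ₗ[k] k) (y : C ⊗[k] C) :
    rightSlice α ((Bicomodule.outer k C).right.coact y) =
      (rightSlice α ∘ₗ Coalgebra.comul).lTensor C y := by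
  induction y with
  | zero => simp
  | add x y hx hy => simp only [map_add, hx, hy]
  | tmul a b =>
    simp only [Bicomodule.outer, LinearMap.comp_apply, LinearMap.lTensor_tmul, LinearEquiv.coe_coe]
    generalize Coalgebra.comul (R := k) b = s
    induction s with
    | zero => simp
    | tmul y z => simp
    | add x y hx hy => simp only [map_add, TensorProduct.tmul_add, hx, hy]

theorem leftSlice_outer (α : C →ₗ[k] k) (y : C ⊗[k] C) :
    leftSlice α ((Bicomodule.outer k C).left.coact y) =
      (leftSlice α ∘ₗ Coalgebra.comul).rTensor C y := by
  induction y with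
  | zero => simp
  | add x y hx hy => simp only [map_add, hx, hy]
  | tmul a b =>
    simp only [Bicomodule.outer, LinearMap.comp_apply, LinearMap.rTensor_tmul, LinearEquiv.coe_coe]
    generalize Coalgebra.comul (R := k) a = s
    induction s with
    | zero => simp
    | tmul y z => simp [TensorProduct.smul_tmul']
    | add x y hx hy => simp only [map_add, TensorProduct.add_tmul, hx, hy]

/-- Coassociativity: acting by α through the right coaction of C is colinear for the left coaction.
It is needed for stability of the cotensor square. -/
theorem comul_rightSlice_comul (α : C →ₗ[k] k) (c : C) :
    Coalgebra.comul (R := k) (rightSlice α (Coalgebra.comul c)) =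
      (rightSlice α ∘ₗ Coalgebra.comul).lTensor C (Coalgebra.comul c) := by
  have h1 : Coalgebra.comul ∘ₗ rightSlice α =
      (rightSlice α).lTensor C ∘ₗ (TensorProduct.assoc k C C C).toLinearMap ∘ₗ
        (Coalgebra.comul (R := k) (A := C)).rTensor C := by
    ext a b
    simp only [TensorProduct.AlgebraTensorModule.curry_apply, LinearMap.restrictScalars_self,
      TensorProduct.curry_apply, LinearMap.comp_apply, LinearMap.rTensor_tmul,
      LinearEquiv.coe_coe, rightSlice_tmul, map_smul]
    generalize Coalgebra.comul (R := k) a = s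
    induction s with
    | zero => simp
    | tmul y z => simp
    | add x y hx hy => simp only [map_add, TensorProduct.add_tmul, smul_add, hx, hy]
  have a1 := LinearMap.congr_fun h1 (Coalgebra.comul c)
  simp only [LinearMap.comp_apply, LinearEquiv.coe_coe] at a1
  rw [a1, Coalgebra.coassoc_apply, LinearMap.lTensor_comp, LinearMap.comp_apply]

theorem comul_leftSlice_comul (α : C →ₗ[k] k) (c : C) :
    Coalgebra.comul (R := k) (leftSlice α (Coalgebra.comul c)) =
      (leftSlice α ∘ₗ Coalgebra.comul).rTensor C (Coalgebra.comul c) := by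
  have h1 : Coalgebra.comul ∘ₗ leftSlice α =
      (leftSlice α).rTensor C ∘ₗ (TensorProduct.assoc k C C C).symm.toLinearMap ∘ₗ
        (Coalgebra.comul (R := k) (A := C)).lTensor C := by
    ext a b
    simp only [TensorProduct.AlgebraTensorModule.curry_apply, LinearMap.restrictScalars_self,
      TensorProduct.curry_apply, LinearMap.comp_apply, LinearMap.lTensor_tmul,
      LinearEquiv.coe_coe, leftSlice_tmul, map_smul]
    generalize Coalgebra.comul (R := k) b = s
    induction s with
    | zero => simp
    | tmul y z => simp [TensorProduct.smul_tmul']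
    | add x y hx hy => simp only [map_add, TensorProduct.tmul_add, smul_add, hx, hy]
  have a1 := LinearMap.congr_fun h1 (Coalgebra.comul c)
  simp only [LinearMap.comp_apply, LinearEquiv.coe_coe] at a1
  rw [a1, Coalgebra.coassoc_symm_apply, LinearMap.rTensor_comp, LinearMap.comp_apply]

theorem rightSlice_outer_mem {f : C →ₗc[k] D} {y : C ⊗[k] C} (hy : y ∈ selfCotensor f)
    (α : C →ₗ[k] k) : rightSlice α ((Bicomodule.outer k C).right.coact y) ∈ selfCotensor f := by
  -- The right slice of the outer coaction is id ⊗ R. As R is left colinear, id ⊗ R commutes with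
  -- both maps whose equalizer is the cotensor square.
  let R : C →ₗ[k] C := rightSlice α ∘ₗ Coalgebra.comul
  have h1 : cotensorLeft f ∘ₗ R.lTensor C = (R.lTensor D).lTensor C ∘ₗ cotensorLeft f := by
    ext a b
    simp only [TensorProduct.AlgebraTensorModule.curry_apply, LinearMap.restrictScalars_self,
      TensorProduct.curry_apply, LinearMap.comp_apply, LinearMap.lTensor_tmul,
      LinearMap.rTensor_tmul, LinearEquiv.coe_coe, cotensorLeft]
    generalize Coalgebra.comul (R := k) a = s
    induction s with
    | zero => simp
    | tmul y z => simp
    | add x y hx hy => simp only [map_add, TensorProduct.add_tmul, hx, hy]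
  have h2 : cotensorRight f ∘ₗ R.lTensor C = (R.lTensor D).lTensor C ∘ₗ cotensorRight f := by
    rw [cotensorRight, ← LinearMap.lTensor_comp, ← LinearMap.lTensor_comp]
    congr 1
    have h3 : Coalgebra.comul ∘ₗ R = R.lTensor C ∘ₗ Coalgebra.comul :=
      LinearMap.ext fun c => comul_rightSlice_comul α c
    rw [LinearMap.comp_assoc, h3, ← LinearMap.comp_assoc, ← LinearMap.comp_assoc,
      LinearMap.rTensor_comp_lTensor, LinearMap.lTensor_comp_rTensor]
  have a1 := LinearMap.congr_fun h1 y
  have a2 := LinearMap.congr_fun h2 y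
  simp only [LinearMap.comp_apply] at a1 a2
  rw [rightSlice_outer, mem_selfCotensor, a1, a2, mem_selfCotensor.1 hy]

theorem leftSlice_outer_mem {f : C →ₗc[k] D} {y : C ⊗[k] C} (hy : y ∈ selfCotensor f)
    (α : C →ₗ[k] k) : leftSlice α ((Bicomodule.outer k C).left.coact y) ∈ selfCotensor f := by
  let R : C →ₗ[k] C := leftSlice α ∘ₗ Coalgebra.comul
  have h1 : cotensorRight f ∘ₗ R.rTensor C = R.rTensor (D ⊗[k] C) ∘ₗ cotensorRight f := by
    rw [cotensorRight, LinearMap.lTensor_comp_rTensor, LinearMap.rTensor_comp_lTensor]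
  have h2 : cotensorLeft f ∘ₗ R.rTensor C = R.rTensor (D ⊗[k] C) ∘ₗ cotensorLeft f := by
    have h3 : Coalgebra.comul ∘ₗ R = R.rTensor C ∘ₗ Coalgebra.comul :=
      LinearMap.ext fun c => comul_leftSlice_comul α c
    rw [cotensorLeft, LinearMap.comp_assoc, ← LinearMap.rTensor_comp, LinearMap.comp_assoc, h3]
    ext a b
    simp only [TensorProduct.AlgebraTensorModule.curry_apply, LinearMap.restrictScalars_self,
      TensorProduct.curry_apply, LinearMap.comp_apply,
      LinearMap.rTensor_tmul, LinearEquiv.coe_coe]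
    generalize Coalgebra.comul (R := k) a = s
    induction s with
    | zero => simp
    | tmul y z => simp
    | add x y hx hy => simp only [map_add, TensorProduct.add_tmul, hx, hy]
  have a1 := LinearMap.congr_fun h1 y
  have a2 := LinearMap.congr_fun h2 y
  simp only [LinearMap.comp_apply] at a1 a2
  rw [leftSlice_outer, mem_selfCotensor, a1, a2, mem_selfCotensor.1 hy]

/-- The bicomodule structure of the cotensor square. -/
theorem exists_bicomodule_selfCotensor (f : C →ₗc[k] D) :
    ∃ B : Bicomodule k C (selfCotensor f),
      (selfCotensor f).subtype.rTensor C ∘ₗ B.right.coact =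
        (Bicomodule.outer k C).right.coact ∘ₗ (selfCotensor f).subtype ∧
      (selfCotensor f).subtype.lTensor C ∘ₗ B.left.coact =
        (Bicomodule.outer k C).left.coact ∘ₗ (selfCotensor f).subtype :=
  (Bicomodule.outer k C).exists_restrict _ (fun _ hy α => rightSlice_outer_mem hy α)
    fun _ hy α => leftSlice_outer_mem hy α

theorem rTensor_idTensorCounit_outer (f : C →ₗc[k] D) (y : C ⊗[k] C) :
    (idTensorCounit k C).rTensor D
      (f.toLinearMap.lTensor (C ⊗[k] C) ((Bicomodule.outer k C).right.coact y)) =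
      f.toLinearMap.lTensor C y := by
  induction y with
  | zero => simp
  | add x y hx hy => simp only [map_add, hx, hy]
  | tmul a b =>
    have h : ∀ s : C ⊗[k] C, (idTensorCounit k C).rTensor D (f.toLinearMap.lTensor (C ⊗[k] C)
        ((TensorProduct.assoc k C C C).symm (a ⊗ₜ s))) =
        a ⊗ₜ f (leftSlice Coalgebra.counit s) := by
      intro s
      induction s with
      | zero => simp
      | tmul y z => simp [idTensorCounit, TensorProduct.smul_tmul]
      | add x y hx hy => simp only [map_add, TensorProduct.tmul_add, hx, hy]
    refine (h (Coalgebra.comul b)).trans ?_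
    rw [show leftSlice Coalgebra.counit (Coalgebra.comul (R := k) b) = b from
      (LeftComodule.regular k C).leftSlice_counit _]
    simp

end Cotensor

/-! ### From the cotensor condition to (b), (e), (g), and from (g), (h) back. -/

section Conditions

variable {k : Type u} [Field k]
variable {C : Type u} [AddCommGroup C] [Module k C] [Coalgebra k C]
variable {D : Type u} [AddCommGroup D] [Module k D] [Coalgebra k D]
variable {D' : Type u} [AddCommGroup D'] [Module k D'] [Coalgebra k D']
variable {f : C →ₗc[k] D} {π : C →ₗc[k] D'}

theorem CoequalizesCotensor.apply (h : CoequalizesCotensor f π) {y : C ⊗[k] C}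
    (hy : y ∈ selfCotensor f) : π (idTensorCounit k C y) = π (counitTensorId k C y) :=
  LinearMap.congr_fun h ⟨y, hy⟩

theorem CoequalizesCotensor.equalizesPairs (h : CoequalizesCotensor f π) : EqualizesPairs f π := by
  intro C' _ _ _ f₁ f₂ hf
  ext x
  have := h.apply (map_comul_mem_selfCotensor hf x)
  rwa [idTensorCounit_map_comul, counitTensorId_map_comul] at this

/-- If `w₀ ⊗ f w₁ ⊗ c = w ⊗ f c₁ ⊗ c₂` for a tensor `w ⊗ c`, then
`w₀ ε(c) ⊗ π w₁ = w ⊗ π c`. -/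
theorem CoequalizesCotensor.lTensor_coact (h : CoequalizesCotensor f π) {W : Type*}
    [AddCommGroup W] [Module k W] (N : RightComodule k C W) (s : W ⊗[k] C)
    (hs : TensorProduct.assoc k W D C ((f.toLinearMap.lTensor W ∘ₗ N.coact).rTensor C s) =
      (f.toLinearMap.rTensor C ∘ₗ Coalgebra.comul).lTensor W s) :
    π.toLinearMap.lTensor W (N.coact (rightSlice Coalgebra.counit s)) =
      π.toLinearMap.lTensor W s := by
  set t := TensorProduct.assoc k W C C (N.coact.rTensor C s) with ht
  have key : (cotensorLeft f).lTensor W t = (cotensorRight f).lTensor W t := by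
    rw [ht, lTensor_cotensorLeft_coact, lTensor_cotensorRight_coact, hs]
  -- Slicing along W reduces the identity in W ⊗ D' to one about elements of the cotensor square,
  -- where the hypothesis applies.
  have hω : ∀ ω : W →ₗ[k] k, leftSlice ω t ∈ selfCotensor f := by
    intro ω
    rw [mem_selfCotensor, ← leftSlice_lTensor, ← leftSlice_lTensor, key]
  have h1 := lTensor_idTensorCounit_coact N s
  have h2 := lTensor_counitTensorId_coact N s
  rw [← ht] at h1 h2
  rw [← h1]
  refine eq_of_leftSlice _ _ fun ω => ?_
  rw [leftSlice_lTensor, leftSlice_lTensor]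
  refine (h.apply (hω ω)).trans ?_
  rw [← leftSlice_lTensor, h2, leftSlice_lTensor]
  rfl

theorem CoequalizesCotensor.bicomoduleCondition (h : CoequalizesCotensor f π) :
    BicomoduleCondition f π := by
  intro X _ _ B x hx
  -- The tensor used is x₀ ⊗ x₋₁. Its cotensor identity reads x₀ ⊗ f(x₁) ⊗ x₋₁ = x₀ ⊗ f(x₋₂) ⊗ x₋₁,
  -- which is the centrality of x followed by the left coaction on the X leg.
  have key := h.lTensor_coact B.right (TensorProduct.comm k C X (B.left.coact x)) ?_
  · have hc := B.left.leftSlice_counit x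
    rw [← leftSlice_comm, TensorProduct.comm_comm, hc] at key
    refine key.trans ?_
    generalize B.left.coact x = u
    induction u with
    | zero => simp
    | tmul a b => simp
    | add x y hx hy => simp only [map_add, hx, hy]
  -- On pure tensors: Ψ sends x ⊗ d to x₀ ⊗ d ⊗ x₋₁, T sends c ⊗ x ⊗ c' to x ⊗ f(c') ⊗ c, and S
  -- sends c ⊗ c' ⊗ x to x ⊗ f(c) ⊗ c'.
  let Ψ : X ⊗[k] D →ₗ[k] X ⊗[k] (D ⊗[k] C) :=
    (TensorProduct.assoc k X D C).toLinearMap ∘ₗ (TensorProduct.comm k C (X ⊗[k] D)).toLinearMap ∘ₗ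
      (TensorProduct.assoc k C X D).toLinearMap ∘ₗ B.left.coact.rTensor D
  let T : C ⊗[k] (X ⊗[k] C) →ₗ[k] X ⊗[k] (D ⊗[k] C) :=
    (TensorProduct.assoc k X D C).toLinearMap ∘ₗ (TensorProduct.comm k C (X ⊗[k] D)).toLinearMap ∘ₗ
      (f.toLinearMap.lTensor X).lTensor C
  let S : C ⊗[k] (C ⊗[k] X) →ₗ[k] X ⊗[k] (D ⊗[k] C) :=
    (TensorProduct.comm k (D ⊗[k] C) X).toLinearMap ∘ₗ (f.toLinearMap.rTensor C).rTensor X ∘ₗ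
      (TensorProduct.assoc k C C X).symm.toLinearMap
  have h1 : Ψ ∘ₗ f.toLinearMap.lTensor X =
      T ∘ₗ (TensorProduct.assoc k C X C).toLinearMap ∘ₗ B.left.coact.rTensor C := by
    ext x c
    simp only [TensorProduct.AlgebraTensorModule.curry_apply, LinearMap.restrictScalars_self,
      TensorProduct.curry_apply, LinearMap.comp_apply, LinearMap.lTensor_tmul,
      LinearMap.rTensor_tmul, LinearEquiv.coe_coe, Ψ, T]
    generalize B.left.coact x = u
    induction u with
    | zero => simp
    | tmul a b => simp
    | add x y hx hy => simp only [map_add, TensorProduct.add_tmul, hx, hy]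
  have h2 : (TensorProduct.assoc k X D C).toLinearMap ∘ₗ
      (f.toLinearMap.lTensor X ∘ₗ B.right.coact).rTensor C ∘ₗ
        (TensorProduct.comm k C X).toLinearMap = T ∘ₗ B.right.coact.lTensor C := by
    ext c x
    simp [T]
  have h3 : Ψ ∘ₗ (TensorProduct.comm k D X).toLinearMap ∘ₗ f.toLinearMap.rTensor X =
      S ∘ₗ B.left.coact.lTensor C := by
    ext c x
    simp only [TensorProduct.AlgebraTensorModule.curry_apply, LinearMap.restrictScalars_self,
      TensorProduct.curry_apply, LinearMap.comp_apply, LinearMap.lTensor_tmul,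
      LinearMap.rTensor_tmul, LinearEquiv.coe_coe, TensorProduct.comm_tmul, Ψ, S]
    generalize B.left.coact x = u
    induction u with
    | zero => simp
    | tmul a b => simp
    | add x y hx hy => simp only [map_add, TensorProduct.add_tmul, TensorProduct.tmul_add, hx, hy]
  have h4 : (f.toLinearMap.rTensor C ∘ₗ Coalgebra.comul).lTensor X ∘ₗ
      (TensorProduct.comm k C X).toLinearMap = S ∘ₗ (TensorProduct.assoc k C C X).toLinearMap ∘ₗ
        (Coalgebra.comul (R := k) (A := C)).rTensor X := by
    ext c x
    simp [S]
  have a1 := LinearMap.congr_fun h1 (B.right.coact x)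
  have a2 := LinearMap.congr_fun h2 (B.left.coact x)
  have a3 := LinearMap.congr_fun h3 (B.left.coact x)
  have a4 := LinearMap.congr_fun h4 (B.left.coact x)
  have c1 := LinearMap.congr_fun B.comm x
  have c2 := LinearMap.congr_fun B.left.coassoc x
  simp only [LinearMap.comp_apply, LinearEquiv.coe_coe] at a1 a2 a3 a4 c1 c2
  rw [a2, a4, ← c1, c2, ← a1, ← a3]
  exact congrArg Ψ hx

theorem CoequalizesCotensor.colinearCondition (h : CoequalizesCotensor f π) :
    ColinearCondition f π := by
  intro V W _ _ _ _ M N φ hφ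
  ext v
  -- The tensor used is φ(v₀) ⊗ v₁; D-colinearity of φ and coassociativity in V give its cotensor
  -- identity.
  have key := h.lTensor_coact N (φ.rTensor C (M.coact v)) ?_
  · rw [rightSlice_rTensor, M.rightSlice_counit, ← rTensor_lTensor_apply] at key
    exact key
  have h1 : (TensorProduct.assoc k W D C).toLinearMap ∘ₗ
      (φ.rTensor D ∘ₗ f.toLinearMap.lTensor V ∘ₗ M.coact).rTensor C =
      φ.rTensor (D ⊗[k] C) ∘ₗ (f.toLinearMap.rTensor C).lTensor V ∘ₗ
        (TensorProduct.assoc k V C C).toLinearMap ∘ₗ M.coact.rTensor C := by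
    ext v c
    simp only [TensorProduct.AlgebraTensorModule.curry_apply, LinearMap.restrictScalars_self,
      TensorProduct.curry_apply, LinearMap.comp_apply, LinearMap.rTensor_tmul, LinearEquiv.coe_coe]
    generalize M.coact v = u
    induction u with
    | zero => simp
    | tmul a b => simp
    | add x y hx hy => simp only [map_add, TensorProduct.add_tmul, hx, hy]
  have h2 : (f.toLinearMap.lTensor W ∘ₗ N.coact) ∘ₗ φ =
      φ.rTensor D ∘ₗ f.toLinearMap.lTensor V ∘ₗ M.coact := hφ
  have a1 := LinearMap.congr_fun h1 (M.coact v)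
  have c1 := LinearMap.congr_fun M.coassoc v
  simp only [LinearMap.comp_apply, LinearEquiv.coe_coe] at a1 c1
  rw [← LinearMap.comp_apply (LinearMap.rTensor C _), ← LinearMap.rTensor_comp, h2, a1, c1,
    ← rTensor_lTensor_apply, LinearMap.lTensor_comp, LinearMap.comp_apply]

/-- Test the condition on φ = id ⊗ ε from the cotensor square, with its right outer coaction, to C.
For a morphism g out of C, colinearity of φ along g says a₁ε(b) ⊗ g(a₂) = a ⊗ g(b): this holds for g
= f by the cotensor identity, and for g = π it yields the claim on applying ε. -/
theorem ColinearCondition.coequalizesCotensor (h : ColinearCondition f π) :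
    CoequalizesCotensor f π := by
  obtain ⟨B, hB, -⟩ := exists_bicomodule_selfCotensor f
  let φ : selfCotensor f →ₗ[k] C := idTensorCounit k C ∘ₗ (selfCotensor f).subtype
  have key : ∀ {E : Type u} [AddCommGroup E] [Module k E] [Coalgebra k E] (g : C →ₗc[k] E)
      (y : selfCotensor f), φ.rTensor E (g.toLinearMap.lTensor _ (B.right.coact y)) =
        g.toLinearMap.lTensor C y := by
    intro E _ _ _ g y
    have h1 := LinearMap.congr_fun hB y
    simp only [LinearMap.comp_apply, Submodule.subtype_apply] at h1
    rw [← rTensor_idTensorCounit_outer g y, ← h1, LinearMap.rTensor_comp, LinearMap.comp_apply]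
    rw [rTensor_lTensor_apply]
  have h1 := h _ _ B.right (RightComodule.regular k C) φ
    (LinearMap.ext fun y => (lTensor_comul_idTensorCounit y.2).trans (key f y).symm)
  ext y
  exact map_idTensorCounit_eq ((LinearMap.congr_fun h1 y).trans (key π y))

theorem FiniteColinearCondition.colinearCondition (h : FiniteColinearCondition f π) :
    ColinearCondition f π := by
  intro V W _ _ _ _ M N φ hφ
  ext v
  obtain ⟨V', hV, hvV, hVc⟩ := M.exists_finite_closed {v} (Set.finite_singleton v)
  obtain ⟨t, ht⟩ : ∃ t : Finset V, Submodule.span k t = V' :=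
    (Submodule.fg_iff_finiteDimensional V').2 hV
  -- W' need only contain the images of finitely many generators of V' for φ to restrict to V' → W'.
  obtain ⟨W', hW, htW, hWc⟩ := N.exists_finite_closed (φ '' t) (t.finite_toSet.image _)
  have hφVW : ∀ x ∈ V', φ x ∈ W' := by
    have : V' ≤ W'.comap φ := by
      rw [← ht, Submodule.span_le]
      exact fun x hx => htW ⟨x, hx, rfl⟩
    exact fun x hx => this hx
  obtain ⟨M', hM'⟩ := M.exists_restrict V' hVc
  obtain ⟨N', hN'⟩ := N.exists_restrict W' hWc
  let φ' : V' →ₗ[k] W' := φ.restrict hφVW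
  have hφ' : W'.subtype ∘ₗ φ' = φ ∘ₗ V'.subtype := rfl
  have key1 : ∀ {E : Type u} [AddCommGroup E] [Module k E] [Coalgebra k E] (g : C →ₗc[k] E)
      (x : V'), W'.subtype.rTensor E ((N'.corestrict g).coact (φ' x)) =
        (N.corestrict g).coact (φ x) := by
    intro E _ _ _ g x
    have h1 := LinearMap.congr_fun hN' (φ' x)
    simp only [LinearMap.comp_apply] at h1
    simp only [RightComodule.corestrict, LinearMap.comp_apply]
    rw [rTensor_lTensor_apply, h1]
    rfl
  have key2 : ∀ {E : Type u} [AddCommGroup E] [Module k E] [Coalgebra k E] (g : C →ₗc[k] E)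
      (x : V'), W'.subtype.rTensor E (φ'.rTensor E ((M'.corestrict g).coact x)) =
        φ.rTensor E ((M.corestrict g).coact x) := by
    intro E _ _ _ g x
    have h1 := LinearMap.congr_fun hM' x
    simp only [LinearMap.comp_apply] at h1
    simp only [RightComodule.corestrict, LinearMap.comp_apply]
    rw [← LinearMap.comp_apply, ← LinearMap.rTensor_comp, hφ', LinearMap.rTensor_comp,
      LinearMap.comp_apply, rTensor_lTensor_apply, h1]
    rfl
  have hcol := h V' W' M' N' φ' (LinearMap.ext fun x =>
    Module.Flat.rTensor_preserves_injective_linearMap W'.subtype W'.injective_subtype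
      ((key1 f x).trans ((LinearMap.congr_fun hφ x).trans (key2 f x).symm)))
  have hv := LinearMap.congr_fun hcol ⟨v, hvV rfl⟩
  exact (key1 π ⟨v, hvV rfl⟩).symm.trans ((congrArg _ hv).trans (key2 π ⟨v, hvV rfl⟩))

end Conditions

/-! ### Contracting the coactions of a bicomodule with a functional. -/

section Contractions

variable {k : Type*} [Field k]
variable {C : Type*} [AddCommGroup C] [Module k C] [Coalgebra k C]
variable {Y : Type*} [AddCommGroup Y] [Module k Y]

/-- The map `y ↦ λ(y₀) y₁`. -/
def Bicomodule.contractRight (B : Bicomodule k C Y) (l : Y →ₗ[k] k) : Y →ₗ[k] C :=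
  leftSlice l ∘ₗ B.right.coact

/-- The map `y ↦ λ(y₀) y₋₁`. -/
def Bicomodule.contractLeft (B : Bicomodule k C Y) (l : Y →ₗ[k] k) : Y →ₗ[k] C :=
  rightSlice l ∘ₗ B.left.coact

theorem Bicomodule.comul_contractRight (B : Bicomodule k C Y) (l : Y →ₗ[k] k) (y : Y) :
    Coalgebra.comul (B.contractRight l y) = (B.contractRight l).rTensor C (B.right.coact y) := by
  have h1 : (leftSlice l).rTensor C ∘ₗ (TensorProduct.assoc k Y C C).symm.toLinearMap =
      leftSlice (V := C ⊗[k] C) l := by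
    ext; simp [TensorProduct.smul_tmul']
  have a1 := LinearMap.congr_fun h1
    (TensorProduct.assoc k Y C C (B.right.coact.rTensor C (B.right.coact y)))
  have a2 := LinearMap.congr_fun B.right.coassoc y
  simp only [LinearMap.comp_apply, LinearEquiv.coe_coe, LinearEquiv.symm_apply_apply] at a1 a2
  rw [contractRight, LinearMap.rTensor_comp, LinearMap.comp_apply, LinearMap.comp_apply, a1, a2,
    leftSlice_lTensor]

theorem Bicomodule.comul_contractLeft (B : Bicomodule k C Y) (l : Y →ₗ[k] k) (y : Y) :
    Coalgebra.comul (B.contractLeft l y) = (B.contractLeft l).lTensor C (B.left.coact y) := by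
  have h1 : (rightSlice l).lTensor C ∘ₗ (TensorProduct.assoc k C C Y).toLinearMap =
      rightSlice (V := C ⊗[k] C) l := by
    ext; simp
  have a1 := LinearMap.congr_fun h1 ((Coalgebra.comul (R := k) (A := C)).rTensor Y (B.left.coact y))
  have a2 := LinearMap.congr_fun B.left.coassoc y
  simp only [LinearMap.comp_apply, LinearEquiv.coe_coe] at a1 a2
  rw [contractLeft, LinearMap.lTensor_comp, LinearMap.comp_apply, LinearMap.comp_apply, ← a2, a1,
    rightSlice_rTensor]

/-- Both sides are y₋₁ ⊗ λ(y₀)y₁. This is the cross term that cancels when the difference of the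
contractions is shown to be a coderivation. -/
theorem Bicomodule.lTensor_contractRight (B : Bicomodule k C Y) (l : Y →ₗ[k] k) (y : Y) :
    (B.contractRight l).lTensor C (B.left.coact y) =
      (B.contractLeft l).rTensor C (B.right.coact y) := by
  have h1 : (leftSlice l).lTensor C ∘ₗ (TensorProduct.assoc k C Y C).toLinearMap =
      (rightSlice l).rTensor C := by
    ext; simp [TensorProduct.smul_tmul]
  have a1 := LinearMap.congr_fun h1 (B.left.coact.rTensor C (B.right.coact y))
  have a2 := LinearMap.congr_fun B.comm y
  simp only [LinearMap.comp_apply, LinearEquiv.coe_coe] at a1 a2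
  rw [contractLeft, contractRight, LinearMap.lTensor_comp, LinearMap.rTensor_comp,
    LinearMap.comp_apply, LinearMap.comp_apply, ← a2, a1]

theorem Bicomodule.counit_contractRight (B : Bicomodule k C Y) (l : Y →ₗ[k] k) (y : Y) :
    Coalgebra.counit (B.contractRight l y) = l y := by
  have h : Coalgebra.counit ∘ₗ leftSlice l =
      l ∘ₗ rightSlice (Coalgebra.counit (R := k) (A := C)) := by
    ext; simp [mul_comm]
  have a := LinearMap.congr_fun h (B.right.coact y)
  simp only [LinearMap.comp_apply, B.right.rightSlice_counit] at a
  exact a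

theorem Bicomodule.counit_contractLeft (B : Bicomodule k C Y) (l : Y →ₗ[k] k) (y : Y) :
    Coalgebra.counit (B.contractLeft l y) = l y := by
  have h : Coalgebra.counit ∘ₗ rightSlice l =
      l ∘ₗ leftSlice (Coalgebra.counit (R := k) (A := C)) := by
    ext; simp [mul_comm]
  have a := LinearMap.congr_fun h (B.left.coact y)
  simp only [LinearMap.comp_apply, B.left.leftSlice_counit] at a
  exact a

end Contractions

/-! ### The trivial extension of a coalgebra by a bicomodule. -/

section TrivialExtension

variable {k : Type*} [Field k]
variable {C : Type*} [AddCommGroup C] [Module k C] [Coalgebra k C]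
variable {Y : Type*} [AddCommGroup Y] [Module k Y]

/-- The trivial extension `C ⊕ Y` of a coalgebra by a bicomodule. -/
@[nolint unusedArguments]
def TrivialExtension (_ : Bicomodule k C Y) : Type _ := C × Y

variable (B : Bicomodule k C Y)

instance : AddCommGroup (TrivialExtension B) := inferInstanceAs (AddCommGroup (C × Y))

instance : Module k (TrivialExtension B) := inferInstanceAs (Module k (C × Y))

/-- The inclusion of `C`. -/
def TrivialExtension.inl : C →ₗ[k] TrivialExtension B := LinearMap.inl k C Y

/-- The inclusion of `Y`. -/
def TrivialExtension.inr : Y →ₗ[k] TrivialExtension B := LinearMap.inr k C Y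

/-- The linear map out of `C ⊕ Y` with given components. -/
def TrivialExtension.desc {Z : Type*} [AddCommGroup Z] [Module k Z] (g : C →ₗ[k] Z)
    (h : Y →ₗ[k] Z) : TrivialExtension B →ₗ[k] Z := LinearMap.coprod g h

@[simp]
theorem TrivialExtension.desc_inl {Z : Type*} [AddCommGroup Z] [Module k Z] (g : C →ₗ[k] Z)
    (h : Y →ₗ[k] Z) : desc B g h ∘ₗ inl B = g := LinearMap.coprod_inl g h

@[simp]
theorem TrivialExtension.desc_inr {Z : Type*} [AddCommGroup Z] [Module k Z] (g : C →ₗ[k] Z)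
    (h : Y →ₗ[k] Z) : desc B g h ∘ₗ inr B = h := LinearMap.coprod_inr g h

variable {B} in
theorem TrivialExtension.hom_ext {Z : Type*} [AddCommGroup Z] [Module k Z]
    {g h : TrivialExtension B →ₗ[k] Z} (hl : g ∘ₗ inl B = h ∘ₗ inl B)
    (hr : g ∘ₗ inr B = h ∘ₗ inr B) : g = h := LinearMap.prod_ext hl hr

open TrivialExtension in
instance : CoalgebraStruct k (TrivialExtension B) where
  comul := desc B (TensorProduct.map (inl B) (inl B) ∘ₗ Coalgebra.comul)
    (TensorProduct.map (inl B) (inr B) ∘ₗ B.left.coact +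
      TensorProduct.map (inr B) (inl B) ∘ₗ B.right.coact)
  counit := desc B Coalgebra.counit 0

namespace TrivialExtension

theorem comul_inl : CoalgebraStruct.comul ∘ₗ inl B =
    TensorProduct.map (inl B) (inl B) ∘ₗ Coalgebra.comul := desc_inl ..

theorem comul_inr : CoalgebraStruct.comul ∘ₗ inr B =
    TensorProduct.map (inl B) (inr B) ∘ₗ B.left.coact +
      TensorProduct.map (inr B) (inl B) ∘ₗ B.right.coact := desc_inr ..

theorem counit_inl : CoalgebraStruct.counit ∘ₗ inl B = Coalgebra.counit (R := k) (A := C) :=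
  desc_inl ..

theorem counit_inr : CoalgebraStruct.counit (R := k) ∘ₗ inr B = 0 := desc_inr ..

theorem assoc_map_map {U₁ U₂ U₃ V₁ V₂ V₃ : Type*} [AddCommGroup U₁] [Module k U₁]
    [AddCommGroup U₂] [Module k U₂] [AddCommGroup U₃] [Module k U₃] [AddCommGroup V₁] [Module k V₁]
    [AddCommGroup V₂] [Module k V₂] [AddCommGroup V₃] [Module k V₃] (g₁ : U₁ →ₗ[k] V₁)
    (g₂ : U₂ →ₗ[k] V₂) (g₃ : U₃ →ₗ[k] V₃) (t : (U₁ ⊗[k] U₂) ⊗[k] U₃) :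
    TensorProduct.assoc k V₁ V₂ V₃ (TensorProduct.map (TensorProduct.map g₁ g₂) g₃ t) =
      TensorProduct.map g₁ (TensorProduct.map g₂ g₃) (TensorProduct.assoc k U₁ U₂ U₃ t) := by
  have h : (TensorProduct.assoc k V₁ V₂ V₃).toLinearMap ∘ₗ
      TensorProduct.map (TensorProduct.map g₁ g₂) g₃ =
      TensorProduct.map g₁ (TensorProduct.map g₂ g₃) ∘ₗ
        (TensorProduct.assoc k U₁ U₂ U₃).toLinearMap := by
    ext; simp
  exact LinearMap.congr_fun h t

theorem map_comp_left {U₁ U₂ V₁ V₂ V₃ : Type*} [AddCommGroup U₁] [Module k U₁]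
    [AddCommGroup U₂] [Module k U₂] [AddCommGroup V₁] [Module k V₁]
    [AddCommGroup V₂] [Module k V₂] [AddCommGroup V₃] [Module k V₃] (g : V₁ →ₗ[k] V₃)
    (h : U₁ →ₗ[k] V₁) (g' : U₂ →ₗ[k] V₂) (t : U₁ ⊗[k] U₂) :
    TensorProduct.map (g ∘ₗ h) g' t = TensorProduct.map g g' (h.rTensor U₂ t) := by
  rw [← LinearMap.comp_apply, LinearMap.map_comp_rTensor]

theorem map_comp_right {U₁ U₂ V₁ V₂ V₃ : Type*} [AddCommGroup U₁] [Module k U₁]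
    [AddCommGroup U₂] [Module k U₂] [AddCommGroup V₁] [Module k V₁]
    [AddCommGroup V₂] [Module k V₂] [AddCommGroup V₃] [Module k V₃] (g : V₂ →ₗ[k] V₃)
    (h : U₂ →ₗ[k] V₂) (g' : U₁ →ₗ[k] V₁) (t : U₁ ⊗[k] U₂) :
    TensorProduct.map g' (g ∘ₗ h) t = TensorProduct.map g' g (h.lTensor U₁ t) := by
  rw [← LinearMap.comp_apply, LinearMap.map_comp_lTensor]

end TrivialExtension

open TrivialExtension in
instance : Coalgebra k (TrivialExtension B) where
  coassoc := by
    apply TrivialExtension.hom_ext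
    · ext c
      have a := LinearMap.congr_fun (comul_inl B) c
      simp only [LinearMap.comp_apply, LinearEquiv.coe_coe] at a ⊢
      rw [a, LinearMap.rTensor, LinearMap.lTensor, TensorProduct.map_map, TensorProduct.map_map,
        comul_inl, LinearMap.id_comp, map_comp_left, map_comp_right, assoc_map_map,
        Coalgebra.coassoc_apply]
    · ext y
      have a := LinearMap.congr_fun (comul_inr B) y
      have c1 := LinearMap.congr_fun B.left.coassoc y
      have c2 := LinearMap.congr_fun B.right.coassoc y
      have c3 := LinearMap.congr_fun B.comm y
      simp only [LinearMap.comp_apply, LinearEquiv.coe_coe, LinearMap.add_apply] at a c1 c2 c3 ⊢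
      rw [a, LinearMap.rTensor, LinearMap.lTensor, map_add, map_add]
      simp only [TensorProduct.map_map, comul_inl, comul_inr, LinearMap.id_comp,
        TensorProduct.map_add_left, TensorProduct.map_add_right, LinearMap.add_apply, map_add]
      simp only [map_comp_left, map_comp_right, assoc_map_map]
      -- Sorted by the position of the Y factor, coassociativity on Y splits into left
      -- coassociativity (last), right coassociativity (first) and compatibility of the coactions
      -- (middle).
      rw [c1, c2, c3]
      abel
  rTensor_counit_comp_comul := by
    apply TrivialExtension.hom_ext
    · ext c
      have a := LinearMap.congr_fun (comul_inl B) c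
      have b := Coalgebra.rTensor_counit_comul (R := k) c
      simp only [LinearMap.comp_apply] at a ⊢
      rw [a, LinearMap.rTensor, TensorProduct.map_map, counit_inl, LinearMap.id_comp,
        ← LinearMap.lTensor_comp_rTensor, LinearMap.comp_apply, b]
      simp
    · ext y
      have a := LinearMap.congr_fun (comul_inr B) y
      have b := LinearMap.congr_fun B.left.counit y
      simp only [LinearMap.comp_apply, LinearMap.add_apply] at a b ⊢
      rw [a, LinearMap.rTensor, map_add, TensorProduct.map_map, TensorProduct.map_map, counit_inl,
        counit_inr, LinearMap.id_comp, LinearMap.id_comp,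
        ← LinearMap.lTensor_comp_rTensor, LinearMap.comp_apply, b]
      simp
  lTensor_counit_comp_comul := by
    apply TrivialExtension.hom_ext
    · ext c
      have a := LinearMap.congr_fun (comul_inl B) c
      have b := Coalgebra.lTensor_counit_comul (R := k) c
      simp only [LinearMap.comp_apply] at a ⊢
      rw [a, LinearMap.lTensor, TensorProduct.map_map, counit_inl, LinearMap.id_comp,
        ← LinearMap.rTensor_comp_lTensor, LinearMap.comp_apply, b]
      simp
    · ext y
      have a := LinearMap.congr_fun (comul_inr B) y
      have b := LinearMap.congr_fun B.right.counit y
      simp only [LinearMap.comp_apply, LinearMap.add_apply] at a b ⊢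
      rw [a, LinearMap.lTensor, map_add, TensorProduct.map_map, TensorProduct.map_map, counit_inl,
        counit_inr, LinearMap.id_comp, LinearMap.id_comp,
        ← LinearMap.rTensor_comp_lTensor, ← LinearMap.rTensor_comp_lTensor, LinearMap.comp_apply,
        LinearMap.comp_apply, b]
      simp

/-- A coderivation `δ : Y → C` gives a coalgebra morphism `c + y ↦ c + δ y` out of the trivial
extension. -/
def TrivialExtension.descHom (δ : Y →ₗ[k] C) (hε : Coalgebra.counit ∘ₗ δ = 0)
    (hδ : ∀ y, Coalgebra.comul (δ y) =
      δ.lTensor C (B.left.coact y) + δ.rTensor C (B.right.coact y)) :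
    TrivialExtension B →ₗc[k] C where
  __ := desc B LinearMap.id δ
  counit_comp := by
    apply TrivialExtension.hom_ext
    · rw [LinearMap.comp_assoc, desc_inl, counit_inl, LinearMap.comp_id]
    · rw [LinearMap.comp_assoc, desc_inr, counit_inr, hε]
  map_comp_comul := by
    apply TrivialExtension.hom_ext
    · rw [LinearMap.comp_assoc, comul_inl, LinearMap.comp_assoc, desc_inl, ← LinearMap.comp_assoc,
        ← TensorProduct.map_comp, desc_inl, TensorProduct.map_id]
      rfl
    · rw [LinearMap.comp_assoc, comul_inr, LinearMap.comp_assoc, desc_inr, LinearMap.comp_add,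
        ← LinearMap.comp_assoc, ← LinearMap.comp_assoc, ← TensorProduct.map_comp,
        ← TensorProduct.map_comp, desc_inl, desc_inr]
      exact LinearMap.ext fun y => (hδ y).symm

end TrivialExtension

/-! ### Duals of finite-dimensional bicomodules. -/

section Dual

variable {k : Type*} [Field k]
variable {C : Type*} [AddCommGroup C] [Module k C] [Coalgebra k C]
variable {Y : Type*} [AddCommGroup Y] [Module k Y]

theorem dualTensorHom_lTensor {Z Z' : Type*} [AddCommGroup Z] [Module k Z] [AddCommGroup Z']
    [Module k Z'] (g : Z →ₗ[k] Z') (t : Module.Dual k Y ⊗[k] Z) (y : Y) :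
    dualTensorHom k Y Z' (g.lTensor _ t) y = g (dualTensorHom k Y Z t y) :=
  LinearMap.congr_fun (LinearMap.congr_fun (dualTensorHom_comp_lTensor g) t) y

theorem comm_rTensor_apply {U V V' : Type*} [AddCommGroup U] [Module k U] [AddCommGroup V]
    [Module k V] [AddCommGroup V'] [Module k V'] (g : V →ₗ[k] V') (t : V ⊗[k] U) :
    TensorProduct.comm k V' U (g.rTensor U t) = g.lTensor U (TensorProduct.comm k V U t) := by
  induction t with
  | zero => simp
  | tmul a b => simp
  | add x y hx hy => simp only [map_add, hx, hy]

variable [FiniteDimensional k Y]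

/-- For finite-dimensional Y, tensors in Y* ⊗ Z are the same as linear maps Y → Z, so a coaction on
the dual may be prescribed by its evaluations on Y. -/
theorem exists_coact_of_contract (Z : Type*) [AddCommGroup Z] [Module k Z]
    (F : (Y →ₗ[k] k) →ₗ[k] (Y →ₗ[k] Z)) :
    ∃ ρ : Module.Dual k Y →ₗ[k] Module.Dual k Y ⊗[k] Z,
      ∀ l, dualTensorHom k Y Z (ρ l) = F l := by
  let e := LinearEquiv.ofBijective (dualTensorHom k Y Z) dualTensorHom_bijective
  exact ⟨e.symm.toLinearMap ∘ₗ F, fun l => e.apply_symm_apply (F l)⟩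

theorem dualTensorHom_ext {Z : Type*} [AddCommGroup Z] [Module k Z]
    {s t : Module.Dual k Y ⊗[k] Z}
    (h : ∀ y, dualTensorHom k Y Z s y = dualTensorHom k Y Z t y) : s = t :=
  dualTensorHom_bijective.1 (LinearMap.ext h)

/-- The dual of a finite-dimensional bicomodule is a bicomodule. -/
theorem Bicomodule.exists_dual (B : Bicomodule k C Y) :
    ∃ B' : Bicomodule k C (Module.Dual k Y),
      (∀ l y, dualTensorHom k Y C (B'.right.coact l) y = B.contractLeft l y) ∧
      ∀ l y, dualTensorHom k Y C (TensorProduct.comm k C _ (B'.left.coact l)) y =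
        B.contractRight l y := by
  -- Dualizing swaps sides: the right coaction on Y* comes from the left coaction on Y, and
  -- conversely.
  obtain ⟨ρ, hρ⟩ := exists_coact_of_contract C
    { toFun := B.contractLeft
      map_add' := fun a b => by
        ext y
        simp [contractLeft, rightSlice, LinearMap.lTensor_add]
      map_smul' := fun r a => by
        ext y
        simp [contractLeft, rightSlice, LinearMap.lTensor_smul] }
  obtain ⟨σ', hσ'⟩ := exists_coact_of_contract C
    { toFun := B.contractRight
      map_add' := fun a b => by
        ext y
        simp [contractRight, leftSlice, LinearMap.rTensor_add]
      map_smul' := fun r a => by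
        ext y
        simp [contractRight, leftSlice, LinearMap.rTensor_smul] }
  let σ : Module.Dual k Y →ₗ[k] C ⊗[k] Module.Dual k Y :=
    (TensorProduct.comm k (Module.Dual k Y) C).toLinearMap ∘ₗ σ'
  have hρ : ∀ l : Module.Dual k Y, dualTensorHom k Y C (ρ l) = B.contractLeft l := hρ
  have hσ : ∀ l : Module.Dual k Y, dualTensorHom k Y C (TensorProduct.comm k C _ (σ l)) =
      B.contractRight l := by
    intro l
    simpa [σ] using hσ' l
  have hassoc : ∀ (u : (Module.Dual k Y) ⊗[k] C) (c : C) (y : Y),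
      dualTensorHom k Y (C ⊗[k] C) (TensorProduct.assoc k (Module.Dual k Y) C C (u ⊗ₜ c)) y =
        dualTensorHom k Y C u y ⊗ₜ c := by
    intro u c y
    induction u with
    | zero => simp
    | tmul a b => simp [TensorProduct.smul_tmul']
    | add x y hx hy => simp only [map_add, TensorProduct.add_tmul, LinearMap.add_apply, hx, hy]
  have hsymm : ∀ (c : C) (v : C ⊗[k] Module.Dual k Y) (y : Y),
      dualTensorHom k Y (C ⊗[k] C) (TensorProduct.comm k (C ⊗[k] C) _
        ((TensorProduct.assoc k C C _).symm (c ⊗ₜ v))) y =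
        c ⊗ₜ dualTensorHom k Y C (TensorProduct.comm k C _ v) y := by
    intro c v y
    induction v with
    | zero => simp
    | tmul a b => simp
    | add x y hx hy => simp only [map_add, TensorProduct.tmul_add, LinearMap.add_apply, hx, hy]
  let Bl : LeftComodule k C (Module.Dual k Y) :=
    { coact := σ
      coassoc := by
        ext l
        apply ((TensorProduct.assoc k C C (Module.Dual k Y)).symm.trans
          (TensorProduct.comm k (C ⊗[k] C) (Module.Dual k Y))).injective
        refine dualTensorHom_ext fun y => ?_
        have key : ∀ u : C ⊗[k] Module.Dual k Y, dualTensorHom k Y (C ⊗[k] C)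
            (TensorProduct.comm k (C ⊗[k] C) _ ((TensorProduct.assoc k C C _).symm
              (σ.lTensor C u))) y =
              (dualTensorHom k Y C (TensorProduct.comm k C _ u)).rTensor C (B.right.coact y) := by
          intro u
          induction u with
          | zero => simp
          | add x y hx hy => simp only [map_add, LinearMap.add_apply, LinearMap.rTensor_add, hx, hy]
          | tmul c l =>
            rw [LinearMap.lTensor_tmul, hsymm, hσ]
            simp only [contractRight, LinearMap.comp_apply]
            generalize B.right.coact y = u
            induction u with
            | zero => simp
            | tmul a b => simp [TensorProduct.smul_tmul]
            | add x y hx hy => simp only [map_add, TensorProduct.tmul_add, hx, hy]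
        simp only [LinearMap.comp_apply, LinearEquiv.coe_coe, LinearEquiv.trans_apply,
          LinearEquiv.symm_apply_apply]
        rw [key, hσ, comm_rTensor_apply, dualTensorHom_lTensor, hσ, B.comul_contractRight]
      counit := by
        ext l
        apply (TensorProduct.comm k k (Module.Dual k Y)).injective
        refine dualTensorHom_ext fun y => ?_
        simp only [LinearMap.comp_apply]
        rw [comm_rTensor_apply, dualTensorHom_lTensor, hσ, B.counit_contractRight]
        simp }
  let Br : RightComodule k C (Module.Dual k Y) :=
    { coact := ρ
      coassoc := by
        ext l
        refine dualTensorHom_ext fun y => ?_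
        have key : ∀ t : (Module.Dual k Y) ⊗[k] C, dualTensorHom k Y (C ⊗[k] C)
            (TensorProduct.assoc k (Module.Dual k Y) C C (ρ.rTensor C t)) y =
              (dualTensorHom k Y C t).lTensor C (B.left.coact y) := by
          intro t
          induction t with
          | zero => simp
          | add x y hx hy => simp only [map_add, LinearMap.add_apply, LinearMap.lTensor_add, hx, hy]
          | tmul l c =>
            rw [LinearMap.rTensor_tmul, hassoc, hρ]
            simp only [contractLeft, LinearMap.comp_apply]
            generalize B.left.coact y = u
            induction u with
            | zero => simp
            | tmul a b => simp [TensorProduct.smul_tmul]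
            | add x y hx hy => simp only [map_add, TensorProduct.add_tmul, hx, hy]
        simp only [LinearMap.comp_apply, LinearEquiv.coe_coe]
        rw [key, hρ, dualTensorHom_lTensor, hρ, B.comul_contractLeft]
      counit := by
        ext l
        refine dualTensorHom_ext fun y => ?_
        simp only [LinearMap.comp_apply]
        rw [dualTensorHom_lTensor, hρ, B.counit_contractLeft]
        simp }
  refine ⟨⟨Bl, Br, ?_⟩, fun l y => LinearMap.congr_fun (hρ l) y,
    fun l y => LinearMap.congr_fun (hσ l) y⟩
  ext l
  -- Moving the dual factor to the front lets both sides be evaluated at y, where compatibility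
  -- becomes the identity `lTensor_contractRight`.
  apply (TensorProduct.leftComm k C (Module.Dual k Y) C).injective
  refine dualTensorHom_ext fun y => ?_
  have hlc₁ : ∀ (v : C ⊗[k] Module.Dual k Y) (c : C), dualTensorHom k Y (C ⊗[k] C)
      (TensorProduct.leftComm k C _ C (TensorProduct.assoc k C _ C (v ⊗ₜ c))) y =
        dualTensorHom k Y C (TensorProduct.comm k C _ v) y ⊗ₜ c := by
    intro v c
    induction v with
    | zero => simp
    | tmul a b => simp [TensorProduct.smul_tmul']
    | add x y hx hy => simp only [map_add, TensorProduct.add_tmul, LinearMap.add_apply, hx, hy]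
  have hlc₂ : ∀ (c : C) (t : Module.Dual k Y ⊗[k] C), dualTensorHom k Y (C ⊗[k] C)
      (TensorProduct.leftComm k C _ C (c ⊗ₜ t)) y = c ⊗ₜ dualTensorHom k Y C t y := by
    intro c t
    induction t with
    | zero => simp
    | tmul a b => simp
    | add x y hx hy => simp only [map_add, TensorProduct.tmul_add, LinearMap.add_apply, hx, hy]
  have key₁ : ∀ t : Module.Dual k Y ⊗[k] C, dualTensorHom k Y (C ⊗[k] C)
      (TensorProduct.leftComm k C _ C (TensorProduct.assoc k C _ C (σ.rTensor C t))) y =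
        TensorProduct.comm k C C ((dualTensorHom k Y C t).rTensor C (B.right.coact y)) := by
    intro t
    induction t with
    | zero => simp
    | add x y hx hy => simp only [map_add, LinearMap.add_apply, LinearMap.rTensor_add, hx, hy]
    | tmul l c =>
      rw [LinearMap.rTensor_tmul, hlc₁, hσ]
      simp only [contractRight, LinearMap.comp_apply]
      generalize B.right.coact y = u
      induction u with
      | zero => simp
      | tmul a b => simp [TensorProduct.smul_tmul]
      | add x y hx hy => simp only [map_add, TensorProduct.add_tmul, hx, hy]
  have key₂ : ∀ u : C ⊗[k] Module.Dual k Y, dualTensorHom k Y (C ⊗[k] C)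
      (TensorProduct.leftComm k C _ C (ρ.lTensor C u)) y =
        TensorProduct.comm k C C
          ((dualTensorHom k Y C (TensorProduct.comm k C _ u)).lTensor C (B.left.coact y)) := by
    intro u
    induction u with
    | zero => simp
    | add x y hx hy => simp only [map_add, LinearMap.add_apply, LinearMap.lTensor_add, hx, hy]
    | tmul c l =>
      rw [LinearMap.lTensor_tmul, hlc₂, hρ]
      simp only [contractLeft, LinearMap.comp_apply]
      generalize B.left.coact y = u
      induction u with
      | zero => simp
      | tmul a b => simp
      | add x y hx hy => simp only [map_add, TensorProduct.tmul_add, hx, hy]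
  simp only [LinearMap.comp_apply, LinearEquiv.coe_coe, Bl, Br]
  rw [key₁, key₂, hρ, hσ, B.lTensor_contractRight]

end Dual

/-! ### The functional condition as a bridge from (b) and (f) to (d). -/

section Conditions

variable {k : Type u} [Field k]
variable {C : Type u} [AddCommGroup C] [Module k C] [Coalgebra k C]
variable {D : Type u} [AddCommGroup D] [Module k D] [Coalgebra k D]
variable {D' : Type u} [AddCommGroup D'] [Module k D'] [Coalgebra k D']
variable {f : C →ₗc[k] D} {π : C →ₗc[k] D'}

/-- The dual form of the bicomodule condition: for a functional `λ` on a finite-dimensional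
bicomodule, `λ(y₀) f(y₁) = λ(y₀) f(y₋₁)` for all `y` implies the same for `π`. -/
def FunctionalCondition (f : C →ₗc[k] D) (π : C →ₗc[k] D') : Prop :=
  ∀ (Y : Type u) [AddCommGroup Y] [Module k Y] [FiniteDimensional k Y] (B : Bicomodule k C Y)
    (l : Y →ₗ[k] k), (∀ y, f (B.contractRight l y) = f (B.contractLeft l y)) →
      ∀ y, π (B.contractRight l y) = π (B.contractLeft l y)

theorem EqualizesPairs.functionalCondition (h : EqualizesPairs f π) : FunctionalCondition f π := by
  intro Y _ _ _ B l hl y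
  -- δ is the inner coderivation attached to λ. The morphisms c + y ↦ c + δ(y) and c + y ↦ c agree
  -- after g exactly when g kills the values of δ.
  let δ : Y →ₗ[k] C := B.contractRight l - B.contractLeft l
  have hε : Coalgebra.counit ∘ₗ δ = 0 := by
    ext y
    simp [δ, B.counit_contractRight, B.counit_contractLeft]
  have hδ : ∀ y, Coalgebra.comul (δ y) =
      δ.lTensor C (B.left.coact y) + δ.rTensor C (B.right.coact y) := by
    intro y
    simp only [δ, LinearMap.sub_apply, map_sub, LinearMap.lTensor_sub, LinearMap.rTensor_sub]
    rw [B.comul_contractRight, B.comul_contractLeft, B.lTensor_contractRight]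
    abel
  let f₁ := TrivialExtension.descHom B δ hε hδ
  let f₂ := TrivialExtension.descHom B 0 (by simp) (by simp)
  have key : ∀ {E : Type u} [AddCommGroup E] [Module k E] [Coalgebra k E] (g : C →ₗc[k] E),
      g.comp f₁ = g.comp f₂ ↔ ∀ y, g (B.contractRight l y) = g (B.contractLeft l y) := by
    intro E _ _ _ g
    constructor
    · intro hg y
      have h1 := CoalgHom.congr_fun hg (TrivialExtension.inr B y)
      have h2 : g ((TrivialExtension.desc B LinearMap.id δ ∘ₗ TrivialExtension.inr B) y) =
        g ((TrivialExtension.desc B LinearMap.id 0 ∘ₗ TrivialExtension.inr B) y) := h1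
      rw [TrivialExtension.desc_inr, TrivialExtension.desc_inr] at h2
      simpa [δ, sub_eq_zero] using h2
    · intro hg
      have h1 : g.toLinearMap ∘ₗ TrivialExtension.desc B LinearMap.id δ =
          g.toLinearMap ∘ₗ TrivialExtension.desc B LinearMap.id 0 := by
        apply TrivialExtension.hom_ext
        · simp [LinearMap.comp_assoc]
        · rw [LinearMap.comp_assoc, LinearMap.comp_assoc, TrivialExtension.desc_inr,
            TrivialExtension.desc_inr]
          ext y
          simpa [δ, sub_eq_zero] using hg y
      exact CoalgHom.ext fun x => LinearMap.congr_fun h1 x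
  exact (key π).1 (h _ f₁ f₂ ((key f).2 hl)) y

/-- View λ as an element of the dual bicomodule; evaluating the centrality identity for λ at each y
in Y gives exactly the identity between the two contractions. -/
theorem FiniteBicomoduleCondition.functionalCondition (h : FiniteBicomoduleCondition f π) :
    FunctionalCondition f π := by
  intro Y _ _ _ B l hl
  obtain ⟨B', hr, hl'⟩ := B.exists_dual
  have key : ∀ {E : Type u} [AddCommGroup E] [Module k E] [Coalgebra k E] (g : C →ₗc[k] E),
      B'.IsCentral g l ↔ ∀ y, g (B.contractRight l y) = g (B.contractLeft l y) := by
    intro E _ _ _ g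
    have h1 : ∀ y, dualTensorHom k Y E (g.toLinearMap.lTensor _ (B'.right.coact l)) y =
        g (B.contractLeft l y) := by
      intro y
      rw [dualTensorHom_lTensor, hr]
      rfl
    have h2 : ∀ y, dualTensorHom k Y E (TensorProduct.comm k E _
        (g.toLinearMap.rTensor _ (B'.left.coact l))) y = g (B.contractRight l y) := by
      intro y
      rw [comm_rTensor_apply, dualTensorHom_lTensor, hl']
      rfl
    constructor
    · intro hc y
      rw [← h1, ← h2, show g.toLinearMap.lTensor _ (B'.right.coact l) = _ from hc]
    · intro hy
      exact dualTensorHom_ext fun y => by rw [h1, h2, hy]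
  exact (key π).1 (h _ B' l ((key f).2 hl))

theorem FunctionalCondition.coequalizesCotensor (h : FunctionalCondition f π) :
    CoequalizesCotensor f π := by
  obtain ⟨B, hBr, hBl⟩ := exists_bicomodule_selfCotensor f
  ext y
  obtain ⟨N, hN, hyN, hr, hl⟩ := B.exists_finite_closed {y} (Set.finite_singleton y)
  obtain ⟨B', hBr', hBl'⟩ := B.exists_restrict N hr hl
  let i : N →ₗ[k] C ⊗[k] C := (selfCotensor f).subtype ∘ₗ N.subtype
  have hi : ∀ n, i n ∈ selfCotensor f := fun n => n.1.2
  have hir : i.rTensor C ∘ₗ B'.right.coact = (Bicomodule.outer k C).right.coact ∘ₗ i := by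
    rw [LinearMap.rTensor_comp, LinearMap.comp_assoc, hBr', ← LinearMap.comp_assoc, hBr]
    rfl
  have hil : i.lTensor C ∘ₗ B'.left.coact = (Bicomodule.outer k C).left.coact ∘ₗ i := by
    rw [LinearMap.lTensor_comp, LinearMap.comp_assoc, hBl', ← LinearMap.comp_assoc, hBl]
    rfl
  -- This functional is ε ⊗ ε. For the outer coactions, contracting with it on the right yields ε ⊗
  -- id and on the left id ⊗ ε, so the functional condition becomes the cotensor condition.
  let l : C ⊗[k] C →ₗ[k] k := Coalgebra.counit ∘ₗ idTensorCounit k C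
  have hL : ∀ z : C ⊗[k] C, leftSlice l ((Bicomodule.outer k C).right.coact z) =
      counitTensorId k C z := by
    intro z
    induction z with
    | zero => simp
    | add x y hx hy => simp only [map_add, hx, hy]
    | tmul a b =>
      have : ∀ s : C ⊗[k] C, leftSlice l ((TensorProduct.assoc k C C C).symm (a ⊗ₜ s)) =
          Coalgebra.counit (R := k) a • leftSlice Coalgebra.counit s := by
        intro s
        induction s with
        | zero => simp
        | tmul x y => simp [l, idTensorCounit, smul_smul, mul_comm]
        | add x y hx hy => simp only [map_add, TensorProduct.tmul_add, smul_add, hx, hy]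
      refine (this (Coalgebra.comul b)).trans ?_
      rw [show leftSlice Coalgebra.counit (Coalgebra.comul (R := k) b) = b from
        (LeftComodule.regular k C).leftSlice_counit _]
      simp [counitTensorId]
  have hR : ∀ z : C ⊗[k] C, rightSlice l ((Bicomodule.outer k C).left.coact z) =
      idTensorCounit k C z := by
    intro z
    induction z with
    | zero => simp
    | add x y hx hy => simp only [map_add, hx, hy]
    | tmul a b =>
      have : ∀ s : C ⊗[k] C, rightSlice l (TensorProduct.assoc k C C C (s ⊗ₜ b)) =
          Coalgebra.counit (R := k) b • rightSlice Coalgebra.counit s := by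
        intro s
        induction s with
        | zero => simp
        | tmul x y => simp [l, idTensorCounit, smul_smul]
        | add x y hx hy => simp only [map_add, TensorProduct.add_tmul, smul_add, hx, hy]
      refine (this (Coalgebra.comul a)).trans ?_
      rw [show rightSlice Coalgebra.counit (Coalgebra.comul (R := k) a) = a from
        (RightComodule.regular k C).rightSlice_counit _]
      simp [idTensorCounit]
  have hR' : ∀ n, B'.contractRight (l ∘ₗ i) n = counitTensorId k C (i n) := by
    intro n
    have h1 : leftSlice (C := N) (V := C) (l ∘ₗ i) = leftSlice l ∘ₗ i.rTensor C := by
      ext; simp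
    rw [Bicomodule.contractRight, h1, LinearMap.comp_assoc, hir]
    exact hL (i n)
  have hL' : ∀ n, B'.contractLeft (l ∘ₗ i) n = idTensorCounit k C (i n) := by
    intro n
    have h1 : rightSlice (C := N) (V := C) (l ∘ₗ i) = rightSlice l ∘ₗ i.lTensor C := by
      ext; simp
    rw [Bicomodule.contractLeft, h1, LinearMap.comp_assoc, hil]
    exact hR (i n)
  have key := h N B' (l ∘ₗ i) (fun n => by
    rw [hR', hL']
    exact (map_idTensorCounit_eq (lTensor_comul_idTensorCounit (hi n))).symm) ⟨y, hyN rfl⟩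
  rw [hR', hL'] at key
  exact key.symm

end Conditions

end CoalgDom

theorem mainTheorem9 {k : Type u} [Field k]
    {C : Type u} [AddCommGroup C] [Module k C] [Coalgebra k C]
    {D : Type u} [AddCommGroup D] [Module k D] [Coalgebra k D]
    {D' : Type u} [AddCommGroup D'] [Module k D'] [Coalgebra k D']
    (f : C →ₗc[k] D) (π : C →ₗc[k] D') (hπ : Function.Surjective π) :
    List.TFAE
      [ CoalgDom.Dominates (CoalgCat.ofHom f) (CoalgCat.ofHom π),
        CoalgDom.EqualizesPairs f π,
        CoalgDom.CoequalizesPullback f π,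
        CoalgDom.CoequalizesCotensor f π,
        CoalgDom.BicomoduleCondition f π,
        CoalgDom.FiniteBicomoduleCondition f π,
        CoalgDom.ColinearCondition f π,
        CoalgDom.FiniteColinearCondition f π ] ∧
    ((∃ g : D' →ₗc[k] D, g.comp π = f) →
      List.TFAE
        [ CoalgDom.DominatesBetween (CoalgCat.ofHom f) (CoalgCat.ofHom π),
          CoalgDom.EqualizesPairs f π,
          CoalgDom.CoequalizesPullback f π,
          CoalgDom.CoequalizesCotensor f π,
          CoalgDom.BicomoduleCondition f π,
          CoalgDom.FiniteBicomoduleCondition f π,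
          CoalgDom.ColinearCondition f π,
          CoalgDom.FiniteColinearCondition f π ]) := by
  have tfae : List.TFAE
      [ CoalgDom.Dominates (CoalgCat.ofHom f) (CoalgCat.ofHom π),
        CoalgDom.EqualizesPairs f π,
        CoalgDom.CoequalizesPullback f π,
        CoalgDom.CoequalizesCotensor f π,
        CoalgDom.BicomoduleCondition f π,
        CoalgDom.FiniteBicomoduleCondition f π,
        CoalgDom.ColinearCondition f π,
        CoalgDom.FiniteColinearCondition f π ] := by
    tfae_have 1 → 2 := CoalgDom.EqualizesPairs.of_dominates
    tfae_have 2 → 3 := CoalgDom.EqualizesPairs.coequalizesPullback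
    tfae_have 3 → 1 := CoalgDom.CoequalizesPullback.dominates
    tfae_have 2 → 4 := fun h => h.functionalCondition.coequalizesCotensor
    tfae_have 4 → 2 := CoalgDom.CoequalizesCotensor.equalizesPairs
    tfae_have 4 → 5 := CoalgDom.CoequalizesCotensor.bicomoduleCondition
    tfae_have 5 → 6 := fun h X _ _ _ B x hx => h X B x hx
    tfae_have 6 → 4 := fun h => h.functionalCondition.coequalizesCotensor
    tfae_have 4 → 7 := CoalgDom.CoequalizesCotensor.colinearCondition
    tfae_have 7 → 8 := fun h V W _ _ _ _ _ _ M N φ hφ => h V W M N φ hφ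
    tfae_have 8 → 4 := fun h => h.colinearCondition.coequalizesCotensor
    tfae_finish
  refine ⟨tfae, fun hg => ?_⟩
  rw [List.tfae_cons_cons] at tfae ⊢
  exact ⟨(CoalgDom.dominatesBetween_iff_dominates hg).trans tfae.1, tfae.2⟩
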